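/- **Setting.** Let $\mathcal X,\mathcal A$ be finite sets, $N,T\ge 1$, $p=(p_n)_{1\le n\le N}$ a transition kernel, $p_n(x'\mid x,a)$, and $\rho\in\Delta_{\mathcal X\times\mathcal A}$. A policy is $\pi=(\pi_n)_{1\le n\le N}$ with $\pi_n(\cdot\mid x)\in\Delta_{\mathcal A}$. For nonnegative kernels $q$ and an initial vector $\nu$, let $\mu^{\pi,q,\nu}$ be given by $\mu_0=\nu$, $\mu_{n+1}(x,a)=\sum_{x',a'}\mu_n(x',a')\,q_{n+1}(x\mid x',a')\,\pi_{n+1}(a\mid x)$. Let $P_\pi$ be the product over $n=1,\dots,N$ of the matrices $\big(p_n(x'\mid x,a)\pi_n(a'\mid x')\big)_{(x,a),(x',a')}$, so that $\nu P_\pi=\mu^{\pi,p,\nu}_N$. A policy is *periodic* if $\rho P_\pi=\rho$. Assume that a periodic policy exists and that, for some $\alpha\in[0,1)$, $\|\nu P_\pi-\nu'P_\pi\|_1\le\alpha\|\nu-\nu'\|_1$ for all periodic $\pi$ and all $\nu,\nu'\in\Delta_{\mathcal X\times\mathcal A}$. **Protocol.** For episodes $t=1,\dots,T$, policies $\pi_t$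 are played without reset: $\rho_1=\rho$, $\rho_{t+1}=\rho_tP_{\pi_t}$. In episode $t$ the learner observes one trajectory $(x_{t,n},a_{t,n})_{0\le n\le N}$; given the information $\mathcal F_t$ available before episode $t$ (for which $\pi_t$ is measurable, and which contains the earlier observed trajectories), it has the law of a trajectory started from $\rho_t$ that follows $\pi_t$ and $p$. The losses are $F_t(\mu)=\sum_{n=1}^N f_{t,n}(\mu_n)$, where the functions $f_{t,n}:\mathbb R^{\mathcal X\times\mathcal A}\to\mathbb R$ are arbitrary (possibly depending on the run) convex functions that are $\ell$-Lipschitz for $\|\cdot\|_1$. Let $$N_{t,n}(x,a)=\sum_{s<t}\mathbf 1\{x_{s,n}=x,\,a_{s,n}=a\},\qquad M_{t,n}(x'\mid x,a)=\sum_{s<t}\mathbf 1\{x_{s,n}=x,\,a_{s,n}=a,\,x_{s,n+1}=x'\},$$ $\hat p_{1,n}\equiv 1/|\mathcal X|$ and $\hat p_{t,n+1}(x'\mid x,a)=M_{t,n}(x'\mid x,a)/\max\{1,N_{t,n}(x,a)\}$ for $t\ge2$. Write $\hat\mu_t^{\pi,\nu}=\mu^{\pi,\hat p_t,\nu}$ and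 $\mu_t=\hat\mu_t^{\pi_t,\rho_t}$, and let $\ell_t=(\ell_{t,n})_{1\le n\le N}$ be a (sub)gradient of $F_t$ at $\mu_t$. For $\delta\in(0,1)$ put $C_\delta=\sqrt{2|\mathcal X|\log(|\mathcal X||\mathcal A|NT/\delta)}$ and $$b_{t,n}(x,a)=\frac{C_\delta}{\sqrt{\max\{1,N_{t,n}(x,a)\}}},\qquad \bar b_{t,n}(x,a)=\ell\,(N-n)\,b_{t,n}(x,a).$$ **Algorithm (MDPP-K).** The initial policy $\pi_1$ is arbitrary. For $1\le t<T$ let $K_{t+1}$ be the set of nonnegative sequences $\mu=(\mu_n)_{0\le n\le N}$ with $\mu_0=\rho_{t+1}$, $\sum_a\mu_{n+1}(x,a)=\sum_{x',a'}\mu_n(x',a')\,\hat p_{t+1,n+1}(x\mid x',a')$ for $0\le n<N$, and $$\|\mu_N-\rho\|_1\le\sum_{n=0}^{N-1}\langle\mu_n,b_{t+1,n}\rangle+\alpha\|\rho_{t+1}-\rho\|_1 .$$ If $K_{t+1}\neq\emptyset$, the policy $\pi_{t+1}$ is such that $\mu_{t+1}=\hat\mu_{t+1}^{\pi_{t+1},\rho_{t+1}}$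 minimizes $\eta\langle\ell_t-\bar b_t,\mu\rangle+D_\psi(\mu,\mu_t)$ over $\mu\in K_{t+1}$; otherwise $\pi_{t+1}$ is arbitrary. Here $\eta>0$, $D_\psi$ is the Bregman divergence of a convex function $\psi$ (with any convention for its value at points where $\psi$ has no gradient), and $\langle z,\mu\rangle=\sum_{n=1}^N\langle z_n,\mu_n\rangle$ for sequences. **Proposition.** There are universal constants $C>0$ and $k\in\mathbb N$ such that in every such setting, with probability at least $1-3\delta$, for all periodic policies $\pi$ simultaneously, $$\sum_{t=1}^T\big\langle \ell_t-\bar b_t,\ \hat\mu_t^{\pi,\rho_t}-\hat\mu_t^{\pi,\rho}\big\rangle\ \le\ \frac{C}{1-\alpha}\,\ell\,N^4|\mathcal X|^2\sqrt{|\mathcal A|T}\;\log^k\!\Big(\frac{|\mathcal X||\mathcal A|NT}{\delta}\Big).$$ (That is, the set of outcomes where this fails for some periodic $\pi$ has outer probability at most $3\delta$.) -/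

import Mathlib

open MeasureTheory ProbabilityTheory

universe u v w

/-!
Conventions.  States `X` and actions `A` are finite; vectors indexed by state-action pairs are
functions `X × A → ℝ`.  A transition kernel is `p n x a x'` (probability of moving to `x'` at step
`n` from `x` under `a`), a policy is `π n x a`; only the steps `1 ≤ n ≤ N` are relevant.
A sequence of state-action distributions is `μ n y`; only `0 ≤ n ≤ N` is relevant.
Episodes are numbered from `0`: index `t` is the episode number `t + 1`, so that the episodes
are `t = 0, …, T - 1` and exactly the episodes `s < t` precede episode `t`.
-/
namespace PeriodicMDP

/-- The `L¹` norm of a vector on state-action pairs. -/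
def l1 {X : Type u} {A : Type v} [Fintype X] [Fintype A] (u : X × A → ℝ) : ℝ := ∑ y, |u y|

/-- `p` is a family of probability kernels at the steps `1, …, N`. -/
def IsKernel {X : Type u} {A : Type v} [Fintype X] (N : ℕ) (p : ℕ → X → A → X → ℝ) : Prop :=
  ∀ n ∈ Finset.Icc 1 N, ∀ x a, p n x a ∈ stdSimplex ℝ X

/-- `π` is a (randomized, non-stationary, Markov) policy over the steps `1, …, N`. -/
def IsPolicy {X : Type u} {A : Type v} [Fintype A] (N : ℕ) (π : ℕ → X → A → ℝ) : Prop :=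
  ∀ n ∈ Finset.Icc 1 N, ∀ x, π n x ∈ stdSimplex ℝ A

/-- One-step transition matrix on state-action pairs: `p_n(x' | x, a) π_n(a' | x')`. -/
def stepMatrix {X : Type u} {A : Type v} (p : ℕ → X → A → X → ℝ) (π : ℕ → X → A → ℝ) (n : ℕ) :
    Matrix (X × A) (X × A) ℝ :=
  Matrix.of fun y y' => p n y.1 y.2 y'.1 * π n y'.1 y'.2

/-- The matrix `P_π` of the first `n` steps: the product of the one-step matrices `1, …, n`. -/
def episodeMatrix {X : Type u} {A : Type v} [Fintype X] [Fintype A] [DecidableEq X]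
    [DecidableEq A] (p : ℕ → X → A → X → ℝ) (π : ℕ → X → A → ℝ) :
    ℕ → Matrix (X × A) (X × A) ℝ
  | 0 => 1
  | n + 1 => episodeMatrix p π n * stepMatrix p π (n + 1)

/-- The sequence `μ^{π,ν}` of state-action distributions induced by the policy `π`, the dynamics `p`
and the initial distribution `ν` (the forward equation). -/
def occ {X : Type u} {A : Type v} [Fintype X] [Fintype A]
    (p : ℕ → X → A → X → ℝ) (π : ℕ → X → A → ℝ) (ν : X × A → ℝ) : ℕ → X × A → ℝ
  | 0 => ν
  | n + 1 => fun y =>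
      ∑ y', occ p π ν n y' * p (n + 1) y'.1 y'.2 y.1 * π (n + 1) y.1 y.2

/-- `ν P_π` is the last term of the forward equation. -/
theorem vecMul_episodeMatrix {X : Type u} {A : Type v} [Fintype X] [Fintype A] [DecidableEq X]
    [DecidableEq A] (p : ℕ → X → A → X → ℝ) (π : ℕ → X → A → ℝ) (ν : X × A → ℝ) (n : ℕ) :
    Matrix.vecMul ν (episodeMatrix p π n) = occ p π ν n := by
  induction n with
  | zero => simp [episodeMatrix, occ]
  | succ n ih =>
    rw [episodeMatrix, ← Matrix.vecMul_vecMul, ih]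
    funext y
    simp [occ, Matrix.vecMul, dotProduct, stepMatrix, mul_assoc]

/-- `π` is a periodic policy for the initial distribution `ρ`: `ρ P_π = ρ`. -/
def IsPeriodic {X : Type u} {A : Type v} [Fintype X] [Fintype A] [DecidableEq X]
    [DecidableEq A] (N : ℕ) (p : ℕ → X → A → X → ℝ) (ρ : X × A → ℝ) (π : ℕ → X → A → ℝ) : Prop :=
  IsPolicy N π ∧ Matrix.vecMul ρ (episodeMatrix p π N) = ρ

/-- Contraction with factor `α`, in `L¹` norm, of the episode kernel of every periodic policy. -/
def PeriodicContraction {X : Type u} {A : Type v} [Fintype X] [Fintype A] [DecidableEq X]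
    [DecidableEq A] (N : ℕ) (p : ℕ → X → A → X → ℝ) (ρ : X × A → ℝ) (α : ℝ) : Prop :=
  ∀ π, IsPeriodic N p ρ π → ∀ ν ∈ stdSimplex ℝ (X × A), ∀ ν' ∈ stdSimplex ℝ (X × A),
    l1 (Matrix.vecMul ν (episodeMatrix p π N) - Matrix.vecMul ν' (episodeMatrix p π N))
      ≤ α * l1 (ν - ν')

/-- The initial distributions of the successive episodes when the policies `π 0, π 1, …` are
played without reset: `ρ_1 = ρ` and `ρ_{t+1} = ρ_t P_{π_t}`. -/
def startDist {X : Type u} {A : Type v} [Fintype X] [Fintype A] [DecidableEq X]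
    [DecidableEq A] (N : ℕ) (p : ℕ → X → A → X → ℝ) (ρ : X × A → ℝ)
    (π : ℕ → ℕ → X → A → ℝ) : ℕ → X × A → ℝ
  | 0 => ρ
  | t + 1 => Matrix.vecMul (startDist N p ρ π t) (episodeMatrix p (π t) N)

/-- Probability of the trajectory `y 0, …, y N` under initial law `ν`, dynamics `p`, policy `π`. -/
def trajProb {X : Type u} {A : Type v} (N : ℕ) (p : ℕ → X → A → X → ℝ) (π : ℕ → X → A → ℝ)
    (ν : X × A → ℝ) (y : ℕ → X × A) : ℝ :=
  ν (y 0) * ∏ n ∈ Finset.range N, stepMatrix p π (n + 1) (y n) (y (n + 1))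

/-- Number of visits of the pair `y` at step `n` in the episodes before `t`;
`Y s n` is the state-action pair observed at step `n` of episode `s`. -/
def visits {X : Type u} {A : Type v} [DecidableEq X] [DecidableEq A]
    (Y : ℕ → ℕ → X × A) (t n : ℕ) (y : X × A) : ℕ :=
  ((Finset.range t).filter fun s => Y s n = y).card

/-- Number of transitions from the pair `y` at step `n` to the state `x'` at step `n + 1` in the
episodes before `t`. -/
def transitions {X : Type u} {A : Type v} [DecidableEq X] [DecidableEq A]
    (Y : ℕ → ℕ → X × A) (t n : ℕ) (y : X × A) (x' : X) : ℕ :=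
  ((Finset.range t).filter fun s => Y s n = y ∧ (Y s (n + 1)).1 = x').card

/-- The empirical kernel used in episode `t`: uniform in the first episode, afterwards
`p̂_{t,n}(x' | x, a) = M_{t,n-1}(x' | x, a) / max {1, N_{t,n-1}(x, a)}` for `1 ≤ n ≤ N`. -/
noncomputable def estKernel {X : Type u} {A : Type v} [Fintype X] [DecidableEq X]
    [DecidableEq A] (Y : ℕ → ℕ → X × A) (t : ℕ) : ℕ → X → A → X → ℝ :=
  fun n x a x' =>
    if t = 0 then 1 / (Fintype.card X : ℝ)
    else (transitions Y t (n - 1) (x, a) x' : ℝ) / max 1 (visits Y t (n - 1) (x, a) : ℝ)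

/-- `C_δ = √(2 |X| log (|X| |A| N T / δ))`. -/
noncomputable def bonusConst (X : Type u) (A : Type v) [Fintype X] [Fintype A]
    (N T : ℕ) (δ : ℝ) : ℝ :=
  √(2 * Fintype.card X *
      Real.log ((Fintype.card X : ℝ) * Fintype.card A * N * T / δ))

/-- The bonus `b_{t,n}(x, a) = C_δ / √(max {1, N_{t,n}(x, a)})`. -/
noncomputable def bonus {X : Type u} {A : Type v} [Fintype X] [Fintype A] [DecidableEq X]
    [DecidableEq A] (N T : ℕ) (δ : ℝ) (Y : ℕ → ℕ → X × A) (t n : ℕ) (y : X × A) : ℝ :=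
  bonusConst X A N T δ / √(max 1 (visits Y t n y : ℝ))

/-- The bonus `b̄_{t,n}(x, a) = ℓ (N - n) C_δ / √(max {1, N_{t,n}(x, a)})`. -/
noncomputable def lossBonus {X : Type u} {A : Type v} [Fintype X] [Fintype A] [DecidableEq X]
    [DecidableEq A] (N T : ℕ) (δ ℓ : ℝ) (Y : ℕ → ℕ → X × A) (t n : ℕ) (y : X × A) : ℝ :=
  ℓ * ((N : ℝ) - n) * bonusConst X A N T δ / √(max 1 (visits Y t n y : ℝ))

/-- `⟨z, μ⟩ = ∑_{n=1}^N ⟨z_n, μ_n⟩`, the pairing of sequences of vectors. -/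
def pairing {X : Type u} {A : Type v} [Fintype X] [Fintype A] (N : ℕ)
    (z μ : ℕ → X × A → ℝ) : ℝ :=
  ∑ n ∈ Finset.Icc 1 N, ∑ y, z n y * μ n y

/-- The set `M_ν^p` of nonnegative sequences that start at `ν` and satisfy the dynamics `p`.
The terms have mass one when `p` is a probability kernel; an empirical kernel has zero rows at
unvisited pairs. -/
def flowSet {X : Type u} {A : Type v} [Fintype X] [Fintype A] (N : ℕ)
    (p : ℕ → X → A → X → ℝ) (ν : X × A → ℝ) : Set (ℕ → X × A → ℝ) :=
  {μ | (∀ n ≤ N, ∀ y, 0 ≤ μ n y) ∧ μ 0 = ν ∧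
    ∀ n < N, ∀ x, ∑ a, μ (n + 1) (x, a) = ∑ y, μ n y * p (n + 1) y.1 y.2 x}

/-- The elements `μ` of `M_ν^{q}` with `‖μ_N - ρ‖₁ ≤ ∑_{n=0}^{N-1} ⟨μ_n, b_n⟩ + α ‖ν - ρ‖₁`. -/
def feasibleSet {X : Type u} {A : Type v} [Fintype X] [Fintype A] (N : ℕ)
    (q : ℕ → X → A → X → ℝ) (ν ρ : X × A → ℝ) (b : ℕ → X × A → ℝ) (α : ℝ) :
    Set (ℕ → X × A → ℝ) :=
  {μ | μ ∈ flowSet N q ν ∧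
    l1 (μ N - ρ) ≤ (∑ n ∈ Finset.range N, ∑ y, μ n y * b n y) + α * l1 (ν - ρ)}

/-- The terms `0, …, N` of a sequence, as an element of a finite-dimensional space. -/
def trunc {X : Type u} {A : Type v} (N : ℕ) (μ : ℕ → X × A → ℝ) : Fin (N + 1) → X × A → ℝ :=
  fun n => μ n

/-- `D` is the Bregman divergence `ψ(μ) - ψ(μ') - ⟨∇ψ(μ'), μ - μ'⟩` induced by the convex function
`ψ`; at points `μ'` where `ψ` has no gradient (as the entropy on the boundary of the orthant)
any convention for its value is allowed. -/
def IsBregmanDivergence {X : Type u} {A : Type v} [Fintype X] [Fintype A] (N : ℕ)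
    (ψ : (Fin (N + 1) → X × A → ℝ) → ℝ)
    (D : (Fin (N + 1) → X × A → ℝ) → (Fin (N + 1) → X × A → ℝ) → ℝ) : Prop :=
  ConvexOn ℝ {μ | 0 ≤ μ} ψ ∧
    ∀ μ μ', 0 ≤ μ → 0 ≤ μ' → DifferentiableAt ℝ ψ μ' →
      D μ μ' = ψ μ - ψ μ' - fderiv ℝ ψ μ' (μ - μ')

/-- `f` is `ℓ`-Lipschitz for the `L¹` norm. -/
def LipschitzL1 {X : Type u} {A : Type v} [Fintype X] [Fintype A] (ℓ : ℝ)
    (f : (X × A → ℝ) → ℝ) : Prop :=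
  ∀ u v, |f u - f v| ≤ ℓ * l1 (u - v)

/-- `g` is a subgradient of `f` at `u` (the gradient, if the convex function `f` has one). -/
def IsSubgradient {X : Type u} {A : Type v} [Fintype X] [Fintype A]
    (f : (X × A → ℝ) → ℝ) (g u : X × A → ℝ) : Prop :=
  ∀ v, f u + ∑ y, g y * (v y - u y) ≤ f v

/-- A run, over `T` episodes of length `N`, of mirror descent for periodic policies with known
initial distributions, with parameters `α`, `δ`, `ℓ`, `η` and divergence `D`.  On a
filtered probability space, with `𝓕 t` the information available before episode `t`,
* `Y t ω n` is the state-action pair at step `n` of the trajectory observed in episode `t`,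
* `π t ω` is the policy played in episode `t`,
* `f t ω n` are the losses of episode `t` and `g t ω n` the subgradients that the learner uses. -/
structure IsRun {X : Type u} {A : Type v} [Fintype X] [Fintype A] [DecidableEq X] [DecidableEq A]
    {Ω : Type w} [mΩ : MeasurableSpace Ω] (P : Measure Ω) (𝓕 : Filtration ℕ mΩ)
    (N T : ℕ) (p : ℕ → X → A → X → ℝ) (ρ : X × A → ℝ) (α δ ℓ η : ℝ)
    (D : (Fin (N + 1) → X × A → ℝ) → (Fin (N + 1) → X × A → ℝ) → ℝ)
    (f : ℕ → Ω → ℕ → (X × A → ℝ) → ℝ) (g : ℕ → Ω → ℕ → X × A → ℝ)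
    (Y : ℕ → Ω → ℕ → X × A) (π : ℕ → Ω → ℕ → X → A → ℝ) : Prop where
  /-- The losses are convex and `ℓ`-Lipschitz. -/
  loss_convex : ∀ t < T, ∀ ω, ∀ n ∈ Finset.Icc 1 N,
    ConvexOn ℝ Set.univ (f t ω n) ∧ LipschitzL1 ℓ (f t ω n)
  /-- `ℓ_t = ∇F_t(μ_t)` at `μ_t`, the sequence induced by `π_t` and `ρ_t` in the estimated model. -/
  subgradient : ∀ t < T, ∀ ω, ∀ n ∈ Finset.Icc 1 N,
    IsSubgradient (f t ω n) (g t ω n)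
      (occ (estKernel (fun s => Y s ω) t) (π t ω)
        (startDist N p ρ (fun s => π s ω) t) n)
  /-- Every `π_t` is a policy. -/
  policy : ∀ t < T, ∀ ω, IsPolicy N (π t ω)
  /-- `π_t` is chosen before episode `t`. -/
  policy_adapted : ∀ t < T, ∀ n ∈ Finset.Icc 1 N, ∀ x a,
    Measurable[𝓕 t] fun ω => π t ω n x a
  /-- The trajectory of episode `t` is known after episode `t`. -/
  traj_adapted : ∀ t < T, ∀ n ≤ N, ∀ y, MeasurableSet[𝓕 (t + 1)] {ω | Y t ω n = y}
  /-- Given the past, the trajectory observed in episode `t` is one of an agent that starts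
  from `ρ_t` and plays `π_t` in the true dynamics. -/
  traj_law : ∀ t < T, ∀ y : ℕ → X × A,
    P[({ω | ∀ n ≤ N, Y t ω n = y n}).indicator (fun _ => (1 : ℝ)) | 𝓕 t] =ᵐ[P]
      fun ω => trajProb N p (π t ω) (startDist N p ρ (fun s => π s ω) t) y
  /-- From the second episode on, the policy played induces, in the estimated model, a minimizer of
  `η ⟨ℓ_t - b̄_t, μ⟩ + D(μ, μ_t)` over the feasible set, provided this set is nonempty. -/
  mirror_step : ∀ t, t + 1 < T → ∀ ω,
    let q : ℕ → ℕ → X → A → X → ℝ := fun s => estKernel (fun r => Y r ω) s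
    let ρs : ℕ → X × A → ℝ := startDist N p ρ (fun s => π s ω)
    let μs : ℕ → ℕ → X × A → ℝ := fun s => occ (q s) (π s ω) (ρs s)
    let K : Set (ℕ → X × A → ℝ) :=
      feasibleSet N (q (t + 1)) (ρs (t + 1)) ρ (bonus N T δ (fun r => Y r ω) (t + 1)) α
    let obj : (ℕ → X × A → ℝ) → ℝ := fun μ =>
      η * pairing N (g t ω - lossBonus N T δ ℓ (fun r => Y r ω) t) μ
        + D (trunc N μ) (trunc N (μs t))
    K.Nonempty → μs (t + 1) ∈ K ∧ ∀ μ ∈ K, obj (μs (t + 1)) ≤ obj μ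

/-- `∑_t ⟨ℓ_t - b̄_t, μ̂_t^{π, ρ_t} - μ̂_t^{π, ρ}⟩`, for the observed trajectories `Y`, the
played policies `π`, the subgradients `g` and a comparator policy `πc`. -/
noncomputable def diffRegret {X : Type u} {A : Type v} [Fintype X] [Fintype A] [DecidableEq X]
    [DecidableEq A] (N T : ℕ) (p : ℕ → X → A → X → ℝ) (ρ : X × A → ℝ) (δ ℓ : ℝ)
    (g : ℕ → ℕ → X × A → ℝ) (Y : ℕ → ℕ → X × A) (π : ℕ → ℕ → X → A → ℝ)
    (πc : ℕ → X → A → ℝ) : ℝ :=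
  ∑ t ∈ Finset.range T,
    pairing N (g t - lossBonus N T δ ℓ Y t)
      (occ (estKernel Y t) πc (startDist N p ρ π t) - occ (estKernel Y t) πc ρ)

end PeriodicMDP

/-!
Write `ρ_t` for the initial distribution of episode `t` and `d_t = ‖ρ_t - ρ‖₁`.  Rows of the
empirical kernels have mass at most one, so `‖μ̂_t^{π, ρ_t} - μ̂_t^{π, ρ}‖₁ ≤ d_t` for every policy
`π`, and it suffices to bound `∑_t d_t`.

When the empirical kernels are within the bonus of the true one, a contracting policy is feasible,
hence so is the played one, and comparing the estimated with the true dynamics along the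
constraint gives `d_{t+1} ≤ e_t + α d_t`, where `e_t` is a multiple of the bonus that the played
policy is expected to collect in the true dynamics.  Summing, `∑_t d_t ≤ (1 - α)⁻¹ ∑_t e_t`.
The bonus actually collected is at most of order `√T` because `∑_{m < M} 1 / √m` is of order `√M`.

The probabilistic input is twofold: the expected and the collected bonus differ by a martingale
(Azuma–Hoeffding), and, for each set of states, the deviation of the empirical transition counts is
a martingale whose exponential moment is controlled up to the `m`-th visit of a state-action pair.
-/
namespace PeriodicMDP

open Finset

section L1

variable {X : Type u} {A : Type v} [Fintype X] [Fintype A]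

theorem l1_nonneg (u : X × A → ℝ) : 0 ≤ l1 u := sum_nonneg fun _ _ => abs_nonneg _

theorem l1_add_le (u v : X × A → ℝ) : l1 (u + v) ≤ l1 u + l1 v := by
  unfold l1
  rw [← sum_add_distrib]
  exact sum_le_sum fun y _ => abs_add_le _ _

theorem l1_sub_comm (u v : X × A → ℝ) : l1 (u - v) = l1 (v - u) :=
  sum_congr rfl fun _ _ => abs_sub_comm _ _

theorem l1_sub_le (u v w : X × A → ℝ) : l1 (u - w) ≤ l1 (u - v) + l1 (v - w) := by
  simpa only [sub_add_sub_cancel] using l1_add_le (u - v) (v - w)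

theorem l1_of_mem_stdSimplex {u : X × A → ℝ} (hu : u ∈ stdSimplex ℝ (X × A)) : l1 u = 1 :=
  (sum_congr rfl fun y _ => abs_of_nonneg (hu.1 y)).trans hu.2

theorem l1_sub_le_two {u v : X × A → ℝ} (hu : u ∈ stdSimplex ℝ (X × A))
    (hv : v ∈ stdSimplex ℝ (X × A)) : l1 (u - v) ≤ 2 := by
  have h := l1_sub_le u 0 v
  rw [sub_zero, l1_sub_comm 0 v, sub_zero, l1_of_mem_stdSimplex hu, l1_of_mem_stdSimplex hv] at h
  linarith

theorem sum_mul_le_mul_l1 {z : X × A → ℝ} {B : ℝ} (hz : ∀ y, |z y| ≤ B) (u : X × A → ℝ) :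
    ∑ y, z y * u y ≤ B * l1 u := by
  unfold l1
  rw [mul_sum]
  refine sum_le_sum fun y _ => (le_abs_self _).trans ?_
  rw [abs_mul]
  exact mul_le_mul_of_nonneg_right (hz y) (abs_nonneg _)

theorem pairing_sub_le {N : ℕ} {z μ μ' : ℕ → X × A → ℝ} {B r : ℝ} (hB : 0 ≤ B)
    (hz : ∀ n ∈ Icc 1 N, ∀ y, |z n y| ≤ B) (hμ : ∀ n ∈ Icc 1 N, l1 (μ n - μ' n) ≤ r) :
    pairing N z (μ - μ') ≤ N * (B * r) := by
  refine (sum_le_card_nsmul _ _ (B * r) fun n hn => ?_).trans_eq (by simp)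
  exact (sum_mul_le_mul_l1 (hz n hn) _).trans (mul_le_mul_of_nonneg_left (hμ n hn) hB)

theorem abs_le_of_isSubgradient {ℓ : ℝ} {f : (X × A → ℝ) → ℝ} {g u : X × A → ℝ}
    (hf : LipschitzL1 ℓ f) (hg : IsSubgradient f g u) (y : X × A) : |g y| ≤ ℓ := by
  classical
  have directional : ∀ c : ℝ, |c| = 1 → g y * c ≤ ℓ := fun c hc => by
    have hsub := hg (u + Pi.single y c)
    have hlip := (le_abs_self _).trans (hf (u + Pi.single y c) u)
    have hnorm : l1 (u + Pi.single y c - u) = 1 := by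
      rw [add_sub_cancel_left, l1, sum_eq_single y (fun z _ hz => by simp [hz]) (by simp)]
      simpa using hc
    have hpair : ∑ z, g z * ((u + Pi.single y c : X × A → ℝ) z - u z) = g y * c := by
      rw [sum_eq_single y (fun z _ hz => by simp [hz]) (by simp)]
      simp
    rw [hnorm] at hlip
    rw [hpair] at hsub
    linarith
  have hpos := directional 1 (by simp)
  have hneg := directional (-1) (by simp)
  exact abs_le.2 ⟨by linarith, by linarith⟩

end L1

section Dynamics

variable {X : Type u} {A : Type v} [Fintype X]

/-- The rows of `q` at the steps `1, …, N` are nonnegative of mass at most one.  Empirical kernels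
are only of this kind: their rows at unvisited pairs vanish. -/
def IsSubkernel (N : ℕ) (q : ℕ → X → A → X → ℝ) : Prop :=
  ∀ n ∈ Icc 1 N, ∀ x a, (∀ x', 0 ≤ q n x a x') ∧ ∑ x', q n x a x' ≤ 1

/-- At the steps `1, …, N`, the rows of `p` and `q` at `y` are at `L¹` distance at most `b n y`.
As for bonuses, `b n` concerns the transition from step `n` to step `n + 1`. -/
def KernelDistLE (N : ℕ) (p q : ℕ → X → A → X → ℝ) (b : ℕ → X × A → ℝ) : Prop :=
  ∀ n < N, ∀ y : X × A, ∑ x, |p (n + 1) y.1 y.2 x - q (n + 1) y.1 y.2 x| ≤ b n y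

theorem KernelDistLE.symm {N : ℕ} {p q : ℕ → X → A → X → ℝ} {b : ℕ → X × A → ℝ}
    (h : KernelDistLE N p q b) : KernelDistLE N q p b := fun n hn y => by
  simpa only [abs_sub_comm] using h n hn y

theorem IsKernel.isSubkernel {N : ℕ} {p : ℕ → X → A → X → ℝ} (hp : IsKernel N p) :
    IsSubkernel N p :=
  fun n hn x a => ⟨(hp n hn x a).1, (hp n hn x a).2.le⟩

theorem succ_mem_Icc {n N : ℕ} (hn : n < N) : n + 1 ∈ Icc 1 N := by
  rw [mem_Icc]
  omega

variable [Fintype A]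

/-- The image of the vector `w` under step `n` of the dynamics `q` and the policy `π`. -/
def push (q : ℕ → X → A → X → ℝ) (π : ℕ → X → A → ℝ) (n : ℕ) (w : X × A → ℝ) : X × A → ℝ :=
  fun y => ∑ y', w y' * q n y'.1 y'.2 y.1 * π n y.1 y.2

/-- The total `∑_{n < N} ⟨μ_n, b_n⟩` of the rewards `b` along the sequence `μ`. -/
def pathSum (N : ℕ) (μ b : ℕ → X × A → ℝ) : ℝ := ∑ n ∈ range N, ∑ y, μ n y * b n y

/-- The episode kernel of `π` brings every distribution closer to `ρ` by the factor `α`. -/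
def ContractsTo (N : ℕ) (p : ℕ → X → A → X → ℝ) (ρ : X × A → ℝ) (α : ℝ)
    (π : ℕ → X → A → ℝ) : Prop :=
  ∀ ν ∈ stdSimplex ℝ (X × A), l1 (occ p π ν N - ρ) ≤ α * l1 (ν - ρ)

theorem PeriodicContraction.contractsTo [DecidableEq X] [DecidableEq A] {N : ℕ}
    {p : ℕ → X → A → X → ℝ} {ρ : X × A → ℝ} {α : ℝ} {π : ℕ → X → A → ℝ}
    (h : PeriodicContraction N p ρ α) (hρ : ρ ∈ stdSimplex ℝ (X × A)) (hπ : IsPeriodic N p ρ π) :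
    ContractsTo N p ρ α π := fun ν hν => by
  simpa only [hπ.2, vecMul_episodeMatrix] using h π hπ ν hν ρ hρ

theorem occ_succ (q : ℕ → X → A → X → ℝ) (π : ℕ → X → A → ℝ) (ν : X × A → ℝ) (n : ℕ) :
    occ q π ν (n + 1) = push q π (n + 1) (occ q π ν n) := rfl

theorem push_sub (q : ℕ → X → A → X → ℝ) (π : ℕ → X → A → ℝ) (n : ℕ) (w w' : X × A → ℝ) :
    push q π n (w - w') = push q π n w - push q π n w' := by
  funext y
  simp [push, sub_mul, sum_sub_distrib]

theorem push_sub_push (q q' : ℕ → X → A → X → ℝ) (π : ℕ → X → A → ℝ) (n : ℕ)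
    (w w' : X × A → ℝ) :
    push q π n w - push q' π n w' = push q π n (w - w') + push (q - q') π n w' := by
  funext y
  simp only [push, Pi.sub_apply, Pi.add_apply]
  rw [← sum_sub_distrib, ← sum_add_distrib]
  exact sum_congr rfl fun y' _ => by ring

variable {N n : ℕ} {p q q' : ℕ → X → A → X → ℝ} {π : ℕ → X → A → ℝ} {ν ν' ρ : X × A → ℝ}
  {b : ℕ → X × A → ℝ} {α C : ℝ}

theorem sum_push_action (q : ℕ → X → A → X → ℝ) (hπ : IsPolicy N π) (hn : n ∈ Icc 1 N)
    (w : X × A → ℝ) (x : X) : ∑ a, push q π n w (x, a) = ∑ y, w y * q n y.1 y.2 x := by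
  unfold push
  rw [sum_comm]
  refine sum_congr rfl fun y _ => ?_
  dsimp only
  rw [← mul_sum, (hπ n hn x).2, mul_one]

theorem sum_push (q : ℕ → X → A → X → ℝ) (hπ : IsPolicy N π) (hn : n ∈ Icc 1 N)
    (w : X × A → ℝ) : ∑ y, push q π n w y = ∑ y, w y * ∑ x, q n y.1 y.2 x := by
  rw [Fintype.sum_prod_type]
  simp_rw [sum_push_action q hπ hn w, mul_sum]
  rw [sum_comm]

theorem l1_push_le (q : ℕ → X → A → X → ℝ) (hπ : IsPolicy N π) (hn : n ∈ Icc 1 N)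
    (w : X × A → ℝ) : l1 (push q π n w) ≤ ∑ y, |w y| * ∑ x, |q n y.1 y.2 x| := by
  refine le_trans (sum_le_sum fun y _ => ?_)
    (sum_push (fun n x a x' => |q n x a x'|) hπ hn fun y => |w y|).le
  refine (abs_sum_le_sum_abs _ _).trans_eq (sum_congr rfl fun y' _ => ?_)
  rw [abs_mul, abs_mul, abs_of_nonneg ((hπ n hn y.1).1 y.2)]

theorem l1_push_le_l1 (hq : IsSubkernel N q) (hπ : IsPolicy N π) (hn : n ∈ Icc 1 N)
    (w : X × A → ℝ) : l1 (push q π n w) ≤ l1 w := by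
  refine (l1_push_le q hπ hn w).trans (sum_le_sum fun y _ => ?_)
  refine mul_le_of_le_one_right (abs_nonneg _) ?_
  simpa only [abs_of_nonneg ((hq n hn y.1 y.2).1 _)] using (hq n hn y.1 y.2).2

theorem occ_nonneg (hq : IsSubkernel N q) (hπ : IsPolicy N π) (hν : ∀ y, 0 ≤ ν y) :
    ∀ n ≤ N, ∀ y, 0 ≤ occ q π ν n y
  | 0, _, y => hν y
  | n + 1, hn, y => sum_nonneg fun y' _ =>
      mul_nonneg (mul_nonneg (occ_nonneg hq hπ hν n (by omega) y')
        ((hq _ (succ_mem_Icc hn) _ _).1 _)) ((hπ _ (succ_mem_Icc hn) _).1 _)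

theorem occ_mem_stdSimplex (hp : IsKernel N p) (hπ : IsPolicy N π)
    (hν : ν ∈ stdSimplex ℝ (X × A)) : ∀ n ≤ N, occ p π ν n ∈ stdSimplex ℝ (X × A)
  | 0, _ => hν
  | n + 1, hn => by
      refine ⟨occ_nonneg hp.isSubkernel hπ hν.1 _ hn, ?_⟩
      rw [occ_succ, sum_push p hπ (succ_mem_Icc hn)]
      simp_rw [(hp _ (succ_mem_Icc hn) _ _).2, mul_one]
      exact (occ_mem_stdSimplex hp hπ hν n (by omega)).2

theorem occ_mem_flowSet (hq : IsSubkernel N q) (hπ : IsPolicy N π) (hν : ∀ y, 0 ≤ ν y) :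
    occ q π ν ∈ flowSet N q ν :=
  ⟨occ_nonneg hq hπ hν, rfl, fun _ hn => sum_push_action q hπ (succ_mem_Icc hn) _⟩

theorem l1_occ_sub_occ_le (hq : IsSubkernel N q) (hπ : IsPolicy N π) (ν ν' : X × A → ℝ) :
    ∀ n ≤ N, l1 (occ q π ν n - occ q π ν' n) ≤ l1 (ν - ν')
  | 0, _ => le_rfl
  | n + 1, hn => by
      rw [occ_succ, occ_succ, ← push_sub]
      exact (l1_push_le_l1 hq hπ (succ_mem_Icc hn) _).trans
        (l1_occ_sub_occ_le hq hπ ν ν' n (by omega))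

theorem l1_occ_sub_occ_le_pathSum (hq : IsSubkernel N q) (hq' : IsSubkernel N q')
    (hπ : IsPolicy N π) (hν : ∀ y, 0 ≤ ν y) (hqq' : KernelDistLE N q q' b) :
    ∀ n ≤ N, l1 (occ q π ν n - occ q' π ν n) ≤ pathSum n (occ q' π ν) b
  | 0, _ => by simp [occ, l1, pathSum]
  | n + 1, hn => by
      rw [occ_succ, occ_succ, push_sub_push, pathSum, sum_range_succ]
      refine (l1_add_le _ _).trans (add_le_add ?_ ?_)
      · exact (l1_push_le_l1 hq hπ (succ_mem_Icc hn) _).trans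
          (l1_occ_sub_occ_le_pathSum hq hq' hπ hν hqq' n (by omega))
      · refine (l1_push_le _ hπ (succ_mem_Icc hn) _).trans (sum_le_sum fun y _ => ?_)
        rw [abs_of_nonneg (occ_nonneg hq' hπ hν n (by omega) y)]
        exact mul_le_mul_of_nonneg_left (hqq' n hn y) (occ_nonneg hq' hπ hν n (by omega) y)

theorem pathSum_le_pathSum {μ : ℕ → X × A → ℝ} {m : ℕ} (hmn : m ≤ n)
    (hμ : ∀ k ≤ n, ∀ y, 0 ≤ μ k y) (hb : ∀ k y, 0 ≤ b k y) : pathSum m μ b ≤ pathSum n μ b :=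
  sum_le_sum_of_subset_of_nonneg (range_mono hmn) fun k hk _ =>
    sum_nonneg fun y _ => mul_nonneg (hμ k (mem_range.1 hk).le y) (hb k y)

theorem pathSum_occ_le (hp : IsSubkernel N p) (hq : IsSubkernel N q) (hπ : IsPolicy N π)
    (hν : ∀ y, 0 ≤ ν y) (hqp : KernelDistLE N q p b) (hC : 0 ≤ C) (hb : ∀ n y, 0 ≤ b n y)
    (hbC : ∀ n y, b n y ≤ C) :
    pathSum N (occ q π ν) b ≤ (1 + N * C) * pathSum N (occ p π ν) b := by
  have hstep : ∀ n ∈ range N, ∑ y, occ q π ν n y * b n y ≤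
      ∑ y, occ p π ν n y * b n y + C * pathSum N (occ p π ν) b := fun n hn => by
    have hn := (mem_range.1 hn).le
    have hdist := (l1_occ_sub_occ_le_pathSum hq hp hπ hν hqp n hn).trans
      (pathSum_le_pathSum hn (occ_nonneg hp hπ hν) hb)
    have hdiff := sum_mul_le_mul_l1 (fun y => (abs_of_nonneg (hb n y)).trans_le (hbC n y))
      (occ q π ν n - occ p π ν n)
    simp only [Pi.sub_apply, mul_comm (b n _), sub_mul, sum_sub_distrib] at hdiff
    linarith [mul_le_mul_of_nonneg_left hdist hC]
  refine (sum_le_sum hstep).trans_eq ?_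
  rw [sum_add_distrib, sum_const, card_range, nsmul_eq_mul, add_mul, one_mul, mul_assoc]
  rfl

theorem occ_mem_feasibleSet (hp : IsSubkernel N p) (hq : IsSubkernel N q) (hπ : IsPolicy N π)
    (hν : ν ∈ stdSimplex ℝ (X × A)) (hpq : KernelDistLE N p q b)
    (hcontr : ContractsTo N p ρ α π) : occ q π ν ∈ feasibleSet N q ν ρ b α := by
  refine ⟨occ_mem_flowSet hq hπ hν.1, ?_⟩
  refine (l1_sub_le _ (occ p π ν N) _).trans (add_le_add ?_ (hcontr ν hν))
  rw [l1_sub_comm]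
  exact l1_occ_sub_occ_le_pathSum hp hq hπ hν.1 hpq N le_rfl

theorem l1_occ_sub_le_of_mem_feasibleSet (hp : IsSubkernel N p) (hq : IsSubkernel N q)
    (hπ : IsPolicy N π) (hν : ∀ y, 0 ≤ ν y) (hpq : KernelDistLE N p q b) (hC : 0 ≤ C)
    (hb : ∀ n y, 0 ≤ b n y) (hbC : ∀ n y, b n y ≤ C)
    (hfeas : occ q π ν ∈ feasibleSet N q ν ρ b α) :
    l1 (occ p π ν N - ρ) ≤
      2 * (1 + N * C) * pathSum N (occ p π ν) b + α * l1 (ν - ρ) := by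
  have htriangle := l1_sub_le (occ p π ν N) (occ q π ν N) ρ
  have hmodel := l1_occ_sub_occ_le_pathSum hp hq hπ hν hpq N le_rfl
  have hconstraint : l1 (occ q π ν N - ρ) ≤ pathSum N (occ q π ν) b + α * l1 (ν - ρ) := hfeas.2
  have hpath := pathSum_occ_le hp hq hπ hν hpq.symm hC hb hbC
  linarith

end Dynamics

section Counts

variable {X : Type u} {A : Type v} [DecidableEq X] [DecidableEq A]

theorem visits_succ (Y : ℕ → ℕ → X × A) (t n : ℕ) (y : X × A) :
    visits Y (t + 1) n y = visits Y t n y + if Y t n = y then 1 else 0 := by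
  unfold visits
  rw [range_add_one, filter_insert]
  split_ifs
  · rw [card_insert_of_notMem (by simp)]
  · rfl

variable [Fintype X]

theorem sum_transitions (Y : ℕ → ℕ → X × A) (t n : ℕ) (y : X × A) :
    ∑ x', transitions Y t n y x' = visits Y t n y := by
  unfold transitions visits
  rw [card_eq_sum_card_fiberwise (f := fun s => (Y s (n + 1)).1) (t := univ)
    fun _ _ => mem_coe.2 (mem_univ _)]
  simp_rw [filter_filter]

theorem estKernel_isSubkernel (N : ℕ) (Y : ℕ → ℕ → X × A) (t : ℕ) :
    IsSubkernel N (estKernel Y t) := by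
  intro n _ x a
  have : Nonempty X := ⟨x⟩
  unfold estKernel
  by_cases ht : t = 0
  · simp [ht]
  · simp only [ht, if_false]
    refine ⟨fun x' => by positivity, ?_⟩
    rw [← sum_div, ← Nat.cast_sum, sum_transitions]
    exact div_le_one_of_le₀ (le_max_right _ _) (by positivity)

variable [Fintype A]

theorem sum_visits (Y : ℕ → ℕ → X × A) (t n : ℕ) : ∑ y, visits Y t n y = t := by
  induction t with
  | zero => simp [visits]
  | succ t ih => simp [visits_succ, sum_add_distrib, ih]

theorem one_div_sqrt_add_le (m : ℕ) :
    1 / √(max 1 (m : ℝ)) + 3 * √(m : ℝ) ≤ 3 * √((m : ℝ) + 1) := by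
  rcases Nat.eq_zero_or_pos m with rfl | hm
  · norm_num
  · have hm' : (1 : ℝ) ≤ m := by exact_mod_cast hm
    have hsq := Real.sq_sqrt (show (0 : ℝ) ≤ m by linarith)
    rw [max_eq_right hm', div_add' _ _ _ (by positivity), div_le_iff₀ (by positivity), mul_assoc,
      mul_assoc, ← sq, hsq, ← Real.sqrt_mul (by positivity)]
    have hgeom : (m : ℝ) + 1 / 3 ≤ √(((m : ℝ) + 1) * m) := Real.le_sqrt_of_sq_le (by nlinarith)
    linarith

theorem sum_one_div_sqrt_visits_le_sum (Y : ℕ → ℕ → X × A) (T n : ℕ) :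
    ∑ t ∈ range T, 1 / √(max 1 (visits Y t n (Y t n) : ℝ)) ≤
      ∑ y, 3 * √(visits Y T n y : ℝ) := by
  induction T with
  | zero => exact sum_nonneg fun y _ => by positivity
  | succ T ih =>
    have hlast : 1 / √(max 1 (visits Y T n (Y T n) : ℝ)) =
        ∑ y, if Y T n = y then 1 / √(max 1 (visits Y T n y : ℝ)) else 0 := by simp
    rw [sum_range_succ, hlast]
    refine (add_le_add_left ih _).trans ?_
    rw [← sum_add_distrib]
    refine sum_le_sum fun y _ => ?_
    rw [visits_succ]
    split_ifs
    · have := one_div_sqrt_add_le (visits Y T n y)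
      push_cast
      linarith
    · simp

theorem sum_one_div_sqrt_visits_le (Y : ℕ → ℕ → X × A) (T n : ℕ) :
    ∑ t ∈ range T, 1 / √(max 1 (visits Y t n (Y t n) : ℝ)) ≤
      3 * √((Fintype.card X : ℝ) * Fintype.card A * T) := by
  refine (sum_one_div_sqrt_visits_le_sum Y T n).trans ?_
  rw [← mul_sum]
  refine mul_le_mul_of_nonneg_left (Real.le_sqrt_of_sq_le ?_) (by norm_num)
  refine sq_sum_le_card_mul_sum_sq.trans_eq ?_
  simp_rw [Real.sq_sqrt (Nat.cast_nonneg _)]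
  rw [← Nat.cast_sum, sum_visits]
  simp

theorem bonusConst_nonneg (X : Type u) (A : Type v) [Fintype X] [Fintype A] (N T : ℕ) (δ : ℝ) :
    0 ≤ bonusConst X A N T δ := Real.sqrt_nonneg _

theorem bonus_nonneg (N T : ℕ) (δ : ℝ) (Y : ℕ → ℕ → X × A) (t n : ℕ) (y : X × A) :
    0 ≤ bonus N T δ Y t n y := div_nonneg (bonusConst_nonneg _ _ _ _ _) (Real.sqrt_nonneg _)

theorem bonus_le (N T : ℕ) (δ : ℝ) (Y : ℕ → ℕ → X × A) (t n : ℕ) (y : X × A) :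
    bonus N T δ Y t n y ≤ bonusConst X A N T δ :=
  div_le_self (bonusConst_nonneg _ _ _ _ _) (Real.one_le_sqrt.2 (le_max_left _ _))

theorem bonus_zero (N T : ℕ) (δ : ℝ) (Y : ℕ → ℕ → X × A) (n : ℕ) (y : X × A) :
    bonus N T δ Y 0 n y = bonusConst X A N T δ := by
  simp [bonus, visits]

theorem abs_lossBonus_le {N n : ℕ} {ℓ : ℝ} (hℓ : 0 ≤ ℓ) (hn : n ≤ N) (T : ℕ) (δ : ℝ)
    (Y : ℕ → ℕ → X × A) (t : ℕ) (y : X × A) :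
    |lossBonus N T δ ℓ Y t n y| ≤ ℓ * N * bonusConst X A N T δ := by
  have hn' : (0 : ℝ) ≤ N - n := sub_nonneg.2 (by exact_mod_cast hn)
  have heq : lossBonus N T δ ℓ Y t n y = ℓ * (N - n) * bonus N T δ Y t n y := mul_div_assoc _ _ _
  rw [heq, abs_of_nonneg (mul_nonneg (mul_nonneg hℓ hn') (bonus_nonneg ..))]
  gcongr
  · exact bonus_nonneg ..
  · exact sub_le_self _ n.cast_nonneg
  · exact bonus_le ..

end Counts

section Regret

variable {X : Type u} {A : Type v} [Fintype X] [Fintype A] [DecidableEq X] [DecidableEq A]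

/-- The law of the state-action pairs of episode `t`, in the true dynamics `p`, when the policies
`π 0, π 1, …` are played without reset from `ρ`. -/
def playedOcc (N : ℕ) (p : ℕ → X → A → X → ℝ) (ρ : X × A → ℝ) (π : ℕ → ℕ → X → A → ℝ) (t : ℕ) :
    ℕ → X × A → ℝ :=
  occ p (π t) (startDist N p ρ π t)

/-- The constraint set `K_t` of the algorithm in episode `t`. -/
def episodeFeasibleSet (N T : ℕ) (p : ℕ → X → A → X → ℝ) (ρ : X × A → ℝ) (α δ : ℝ)
    (Y : ℕ → ℕ → X × A) (π : ℕ → ℕ → X → A → ℝ) (t : ℕ) : Set (ℕ → X × A → ℝ) :=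
  feasibleSet N (estKernel Y t) (startDist N p ρ π t) ρ (bonus N T δ Y t) α

/-- From the second episode on, the bonus dominates the `L¹` error of the empirical kernel. -/
def ModelAccurate (N T : ℕ) (p : ℕ → X → A → X → ℝ) (δ : ℝ) (Y : ℕ → ℕ → X × A) : Prop :=
  ∀ t, t + 1 < T → KernelDistLE N p (estKernel Y (t + 1)) (bonus N T δ Y (t + 1))

/-- The excess, over all episodes, of the expected bonus at step `n` over the collected one. -/
noncomputable def bonusExcess (N T : ℕ) (p : ℕ → X → A → X → ℝ) (ρ : X × A → ℝ) (δ : ℝ)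
    (Y : ℕ → ℕ → X × A) (π : ℕ → ℕ → X → A → ℝ) (n : ℕ) : ℝ :=
  ∑ t ∈ range T,
    (∑ y, playedOcc N p ρ π t n y * bonus N T δ Y t n y - bonus N T δ Y t n (Y t n))

theorem sum_range_le_of_le_add_mul {d e : ℕ → ℝ} {α : ℝ} {T : ℕ} (hα : α < 1) (hd0 : d 0 = 0)
    (hdT : 0 ≤ d T) (hrec : ∀ t < T, d (t + 1) ≤ e t + α * d t) :
    ∑ t ∈ range T, d t ≤ (1 - α)⁻¹ * ∑ t ∈ range T, e t := by
  have hshift : ∑ t ∈ range T, d t ≤ ∑ t ∈ range T, d (t + 1) := by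
    linarith [sum_range_succ d T, sum_range_succ' d T]
  have hsum := sum_le_sum fun t ht => hrec t (mem_range.1 ht)
  rw [sum_add_distrib, ← mul_sum] at hsum
  rw [inv_mul_eq_div, le_div_iff₀ (by linarith)]
  linarith

variable {N T : ℕ} {p : ℕ → X → A → X → ℝ} {ρ : X × A → ℝ} {α δ ℓ r : ℝ}
  {Y : ℕ → ℕ → X × A} {π : ℕ → ℕ → X → A → ℝ} {πc : ℕ → X → A → ℝ}

theorem startDist_succ (N : ℕ) (p : ℕ → X → A → X → ℝ) (ρ : X × A → ℝ)
    (π : ℕ → ℕ → X → A → ℝ) (t : ℕ) : startDist N p ρ π (t + 1) = playedOcc N p ρ π t N :=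
  vecMul_episodeMatrix _ _ _ _

theorem startDist_mem_stdSimplex (hp : IsKernel N p) (hρ : ρ ∈ stdSimplex ℝ (X × A))
    (hπ : ∀ t < T, IsPolicy N (π t)) : ∀ t ≤ T, startDist N p ρ π t ∈ stdSimplex ℝ (X × A)
  | 0, _ => hρ
  | t + 1, ht => by
      rw [startDist_succ]
      exact occ_mem_stdSimplex hp (hπ t ht)
        (startDist_mem_stdSimplex hp hρ hπ t (by omega)) N le_rfl

theorem playedOcc_mem_stdSimplex (hp : IsKernel N p) (hρ : ρ ∈ stdSimplex ℝ (X × A))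
    (hπ : ∀ t < T, IsPolicy N (π t)) {t n : ℕ} (ht : t < T) (hn : n ≤ N) :
    playedOcc N p ρ π t n ∈ stdSimplex ℝ (X × A) :=
  occ_mem_stdSimplex hp (hπ t ht) (startDist_mem_stdSimplex hp hρ hπ t ht.le) n hn

theorem episodeFeasibleSet_nonempty (hp : IsKernel N p) (hρ : ρ ∈ stdSimplex ℝ (X × A))
    (hπ : ∀ t < T, IsPolicy N (π t)) (hM : ModelAccurate N T p δ Y)
    (hcontr : ∃ πs, IsPolicy N πs ∧ ContractsTo N p ρ α πs) {t : ℕ} (ht : t + 1 < T) :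
    (episodeFeasibleSet N T p ρ α δ Y π (t + 1)).Nonempty :=
  let ⟨_, hπs, hcontr⟩ := hcontr
  ⟨_, occ_mem_feasibleSet hp.isSubkernel (estKernel_isSubkernel N Y _) hπs
    (startDist_mem_stdSimplex hp hρ hπ _ ht.le) (hM t ht) hcontr⟩

theorem pathSum_playedOcc_zero (hp : IsKernel N p) (hρ : ρ ∈ stdSimplex ℝ (X × A))
    (hT : 0 < T) (hπ : ∀ t < T, IsPolicy N (π t)) :
    pathSum N (playedOcc N p ρ π 0) (bonus N T δ Y 0) = N * bonusConst X A N T δ := by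
  simp only [pathSum, bonus_zero, ← sum_mul]
  rw [sum_congr rfl fun n hn =>
    (playedOcc_mem_stdSimplex hp hρ hπ hT (mem_range.1 hn).le).2]
  simp

theorem l1_startDist_succ_sub_le (hN : 1 ≤ N) (hp : IsKernel N p)
    (hρ : ρ ∈ stdSimplex ℝ (X × A)) (hπ : ∀ t < T, IsPolicy N (π t))
    (hC : 1 ≤ bonusConst X A N T δ) (hM : ModelAccurate N T p δ Y)
    (hfeas : ∀ t, t + 1 < T → occ (estKernel Y (t + 1)) (π (t + 1)) (startDist N p ρ π (t + 1)) ∈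
      episodeFeasibleSet N T p ρ α δ Y π (t + 1)) :
    ∀ t < T, l1 (startDist N p ρ π (t + 1) - ρ) ≤
      2 * (1 + N * bonusConst X A N T δ) * pathSum N (playedOcc N p ρ π t) (bonus N T δ Y t) +
        α * l1 (startDist N p ρ π t - ρ)
  | 0, hT => by
      have hNC : 1 ≤ N * bonusConst X A N T δ :=
        one_le_mul_of_one_le_of_one_le (by exact_mod_cast hN) hC
      have htwo := l1_sub_le_two (startDist_mem_stdSimplex hp hρ hπ 1 hT) hρ
      have hstart : l1 (startDist N p ρ π 0 - ρ) = 0 := by simp [startDist, l1]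
      rw [pathSum_playedOcc_zero hp hρ hT hπ, hstart, zero_add]
      nlinarith
  | t + 1, ht => by
      rw [startDist_succ N p ρ π (t + 1)]
      exact l1_occ_sub_le_of_mem_feasibleSet hp.isSubkernel (estKernel_isSubkernel N Y _)
        (hπ _ ht) (startDist_mem_stdSimplex hp hρ hπ _ ht.le).1 (hM t ht)
        (bonusConst_nonneg X A N T δ) (bonus_nonneg N T δ Y _) (bonus_le N T δ Y _) (hfeas t ht)

theorem sum_pathSum_playedOcc_le (hr : ∀ n < N, bonusExcess N T p ρ δ Y π n ≤ r) :
    ∑ t ∈ range T, pathSum N (playedOcc N p ρ π t) (bonus N T δ Y t) ≤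
      N * (3 * bonusConst X A N T δ * √((Fintype.card X : ℝ) * Fintype.card A * T) + r) := by
  unfold pathSum
  rw [sum_comm]
  refine (sum_le_card_nsmul (range N) _ _ fun n hn => ?_).trans_eq (by
    rw [card_range, nsmul_eq_mul])
  have hcollected : ∑ t ∈ range T, bonus N T δ Y t n (Y t n) ≤
      3 * bonusConst X A N T δ * √((Fintype.card X : ℝ) * Fintype.card A * T) := by
    have h := mul_le_mul_of_nonneg_left (sum_one_div_sqrt_visits_le Y T n)
      (bonusConst_nonneg X A N T δ)
    simp only [mul_sum, mul_one_div] at h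
    exact h.trans_eq (by ring)
  have hexcess := hr n (mem_range.1 hn)
  rw [bonusExcess, sum_sub_distrib] at hexcess
  linarith

theorem sum_l1_startDist_sub_le (hN : 1 ≤ N) (hp : IsKernel N p)
    (hρ : ρ ∈ stdSimplex ℝ (X × A)) (hπ : ∀ t < T, IsPolicy N (π t)) (hα : α < 1)
    (hC : 1 ≤ bonusConst X A N T δ) (hM : ModelAccurate N T p δ Y)
    (hr : ∀ n < N, bonusExcess N T p ρ δ Y π n ≤ r)
    (hfeas : ∀ t, t + 1 < T → occ (estKernel Y (t + 1)) (π (t + 1)) (startDist N p ρ π (t + 1)) ∈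
      episodeFeasibleSet N T p ρ α δ Y π (t + 1)) :
    ∑ t ∈ range T, l1 (startDist N p ρ π t - ρ) ≤
      (1 - α)⁻¹ * (2 * (1 + N * bonusConst X A N T δ) * (N *
        (3 * bonusConst X A N T δ * √((Fintype.card X : ℝ) * Fintype.card A * T) + r))) := by
  have := bonusConst_nonneg X A N T δ
  have : 0 ≤ (1 - α)⁻¹ := inv_nonneg.2 (by linarith)
  refine (sum_range_le_of_le_add_mul hα (by simp [startDist, l1]) (l1_nonneg _)
    (l1_startDist_succ_sub_le hN hp hρ hπ hC hM hfeas)).trans ?_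
  rw [← mul_sum]
  gcongr
  exact sum_pathSum_playedOcc_le hr

theorem diffRegret_le {g : ℕ → ℕ → X × A → ℝ} (hℓ : 0 ≤ ℓ)
    (hg : ∀ t < T, ∀ n ∈ Icc 1 N, ∀ y, |g t n y| ≤ ℓ) (hπc : IsPolicy N πc) :
    diffRegret N T p ρ δ ℓ g Y π πc ≤ N * (ℓ * (1 + N * bonusConst X A N T δ)) *
      ∑ t ∈ range T, l1 (startDist N p ρ π t - ρ) := by
  have hC := bonusConst_nonneg X A N T δ
  unfold diffRegret
  rw [mul_sum]
  refine sum_le_sum fun t ht => ?_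
  rw [mul_assoc]
  refine pairing_sub_le (by positivity) (fun n hn y => (abs_sub _ _).trans ?_) fun n hn =>
    l1_occ_sub_occ_le (estKernel_isSubkernel N Y t) hπc _ _ n (mem_Icc.1 hn).2
  have hgrad := hg t (mem_range.1 ht) n hn y
  have hbonus := abs_lossBonus_le hℓ (mem_Icc.1 hn).2 T δ Y t y
  linarith

end Regret

section Concentration

theorem sum_mul_exp_mul_sub_le {ι : Type*} [Fintype ι] {q z : ι → ℝ} (hq : q ∈ stdSimplex ℝ ι)
    {a b : ℝ} (hz : ∀ i, z i ∈ Set.Icc a b) (c : ℝ) :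
    ∑ i, q i * Real.exp (c * (z i - ∑ j, q j * z j)) ≤ Real.exp (c ^ 2 * (b - a) ^ 2 / 8) := by
  let _ : MeasurableSpace ι := ⊤
  have hmass : ∑ i, ENNReal.ofReal (q i) = 1 := by
    rw [← ENNReal.ofReal_sum_of_nonneg fun i _ => hq.1 i, hq.2, ENNReal.ofReal_one]
  have hint : ∀ h : ι → ℝ, ∫ i, h i ∂(PMF.ofFintype _ hmass).toMeasure = ∑ i, q i * h i :=
    fun h => by
      simp [PMF.integral_eq_sum, ENNReal.toReal_ofReal (hq.1 _)]
  have h := (hasSubgaussianMGF_of_mem_Icc (μ := (PMF.ofFintype _ hmass).toMeasure) (X := z)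
    measurable_from_top.aemeasurable (Filter.Eventually.of_forall hz)).mgf_le c
  simp only [mgf, hint] at h
  refine h.trans_eq (congrArg Real.exp ?_)
  push_cast
  rw [Real.norm_eq_abs, div_pow, sq_abs]
  ring

variable {S : Type*} [Fintype S] {Ω : Type w}

theorem eq_sum_indicator_eq (Z : Ω → S) (G : Ω → S → ℝ) (ω : Ω) :
    G ω (Z ω) = ∑ s, {ω | Z ω = s}.indicator (G · s) ω := by
  rw [sum_eq_single (Z ω) (fun s _ hs => Set.indicator_of_notMem (by simpa using hs.symm) _)
    (by simp)]
  simp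

omit [Fintype S] in
theorem measurable_comp_of_measurableSet_eq [Finite S] {m : MeasurableSpace Ω} {Z : Ω → S}
    (hZ : ∀ s, MeasurableSet {ω | Z ω = s}) {G : Ω → S → ℝ} (hG : ∀ s, Measurable (G · s)) :
    Measurable fun ω => G ω (Z ω) := by
  have := Fintype.ofFinite S
  simp_rw [eq_sum_indicator_eq Z G]
  exact measurable_fun_sum _ fun s _ => (hG s).indicator (hZ s)

variable [mΩ : MeasurableSpace Ω]

/-- `κ t` is a version of the conditional law of the finitely-valued variable `Z t` given `𝓕 t`, and
`Z t` is known at time `t + 1`, for every `t < T`. -/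
structure HasCondLaw (P : Measure Ω) (𝓕 : Filtration ℕ mΩ) (T : ℕ) (Z : ℕ → Ω → S)
    (κ : ℕ → Ω → S → ℝ) : Prop where
  measurableSet_eq : ∀ t < T, ∀ s, MeasurableSet[𝓕 (t + 1)] {ω | Z t ω = s}
  measurable_law : ∀ t < T, ∀ s, Measurable[𝓕 t] (κ t · s)
  law_mem : ∀ t < T, ∀ ω, κ t ω ∈ stdSimplex ℝ S
  condExp_eq : ∀ t < T, ∀ s,
    P[{ω | Z t ω = s}.indicator (fun _ => (1 : ℝ)) | 𝓕 t] =ᵐ[P] (κ t · s)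

/-- Bounded nonnegative predictable functions `Φ t` of mean at most one under the laws `κ t`: the
factors of a nonnegative supermartingale. -/
structure IsSupermartingaleFactor (𝓕 : Filtration ℕ mΩ) (T : ℕ) (κ Φ : ℕ → Ω → S → ℝ) (B : ℝ) :
    Prop where
  measurable : ∀ t < T, ∀ s, Measurable[𝓕 t] (Φ t · s)
  nonneg : ∀ t < T, ∀ ω s, 0 ≤ Φ t ω s
  le_bound : ∀ t < T, ∀ ω s, Φ t ω s ≤ B
  sum_le_one : ∀ t < T, ∀ ω, ∑ s, κ t ω s * Φ t ω s ≤ 1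

variable {P : Measure Ω} {𝓕 : Filtration ℕ mΩ} {T : ℕ}
  {Z : ℕ → Ω → S} {κ Φ : ℕ → Ω → S → ℝ} {B : ℝ}

theorem HasCondLaw.isSupermartingaleFactor_exp (hκ : HasCondLaw P 𝓕 T Z κ)
    {h : ℕ → Ω → S → ℝ} {C c : ℝ} (hc : 0 ≤ c) (hm : ∀ t < T, ∀ s, Measurable[𝓕 t] (h t · s))
    (hC : ∀ t < T, ∀ ω s, h t ω s ∈ Set.Icc 0 C) :
    IsSupermartingaleFactor 𝓕 T κ
      (fun t ω s => Real.exp (c * (∑ s', κ t ω s' * h t ω s' - h t ω s) - c ^ 2 * C ^ 2 / 8))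
      (Real.exp (c * C)) where
  measurable t ht s := by
    have hmean : Measurable[𝓕 t] fun ω => ∑ s', κ t ω s' * h t ω s' :=
      measurable_fun_sum _ fun s' _ => (hκ.measurable_law t ht s').mul (hm t ht s')
    exact (((hmean.sub (hm t ht s)).const_mul c).sub_const _).exp
  nonneg _ _ _ _ := (Real.exp_pos _).le
  le_bound t ht ω s := by
    have hmean : ∑ s', κ t ω s' * h t ω s' ≤ C := by
      refine (sum_le_sum fun s' _ => mul_le_mul_of_nonneg_left (hC t ht ω s').2
        ((hκ.law_mem t ht ω).1 s')).trans_eq ?_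
      rw [← sum_mul, (hκ.law_mem t ht ω).2, one_mul]
    refine Real.exp_le_exp.2 ((sub_le_self _ (by positivity)).trans ?_)
    exact mul_le_mul_of_nonneg_left (by linarith [(hC t ht ω s).1]) hc
  sum_le_one t ht ω := by
    have hoeffding := sum_mul_exp_mul_sub_le (hκ.law_mem t ht ω) (hC t ht ω) (-c)
    simp_rw [Real.exp_sub, ← mul_div_assoc]
    rw [← sum_div, div_le_one (Real.exp_pos _)]
    simpa only [neg_mul_comm, neg_sub, neg_sq, sub_zero] using hoeffding

namespace IsSupermartingaleFactor

theorem measurable_prod (hΦ : IsSupermartingaleFactor 𝓕 T κ Φ B) (hκ : HasCondLaw P 𝓕 T Z κ) :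
    ∀ t ≤ T, Measurable[𝓕 t] fun ω => ∏ i ∈ range t, Φ i ω (Z i ω)
  | 0, _ => by simp
  | t + 1, ht => by
      simp_rw [prod_range_succ]
      exact ((hΦ.measurable_prod hκ t (by omega)).mono (𝓕.mono t.le_succ) le_rfl).mul
        (measurable_comp_of_measurableSet_eq (hκ.measurableSet_eq t ht) fun s =>
          (hΦ.measurable t ht s).mono (𝓕.mono t.le_succ) le_rfl)

theorem prod_nonneg (hΦ : IsSupermartingaleFactor 𝓕 T κ Φ B) {t : ℕ} (ht : t ≤ T) (ω : Ω) :
    0 ≤ ∏ i ∈ range t, Φ i ω (Z i ω) :=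
  Finset.prod_nonneg fun i hi => hΦ.nonneg i ((mem_range.1 hi).trans_le ht) _ _

theorem prod_le (hΦ : IsSupermartingaleFactor 𝓕 T κ Φ B) {t : ℕ} (ht : t ≤ T) (ω : Ω) :
    ∏ i ∈ range t, Φ i ω (Z i ω) ≤ B ^ t := by
  refine (prod_le_prod (fun i hi => hΦ.nonneg i ((mem_range.1 hi).trans_le ht) _ _)
    fun i hi => hΦ.le_bound i ((mem_range.1 hi).trans_le ht) _ _).trans_eq ?_
  simp

end IsSupermartingaleFactor

variable [IsProbabilityMeasure P]

theorem HasCondLaw.integral_comp_le (hκ : HasCondLaw P 𝓕 T Z κ) {t : ℕ} (ht : t < T)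
    {G : Ω → S → ℝ} (hG : ∀ s, Measurable[𝓕 t] (G · s)) (hB : ∀ ω s, |G ω s| ≤ B) {W : Ω → ℝ}
    (hW : Integrable W P) (hGW : ∀ ω, ∑ s, κ t ω s * G ω s ≤ W ω) :
    ∫ ω, G ω (Z t ω) ∂P ≤ ∫ ω, W ω ∂P := by
  set I : S → Ω → ℝ := fun s => {ω | Z t ω = s}.indicator fun _ => 1
  have hI : ∀ s, Integrable (I s) P := fun s =>
    (integrable_const _).indicator (𝓕.le _ _ (hκ.measurableSet_eq t ht s))
  have hGI : ∀ s, Integrable ((G · s) * I s) P := fun s =>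
    (hI s).bdd_mul ((hG s).mono (𝓕.le t) le_rfl).aestronglyMeasurable
      (Filter.Eventually.of_forall (hB · s))
  have hpull : ∀ s, P[(G · s) * I s | 𝓕 t] =ᵐ[P] fun ω => κ t ω s * G ω s := fun s => by
    refine (condExp_stronglyMeasurable_mul_of_bound (𝓕.le t) (hG s).stronglyMeasurable (hI s) B
      (Filter.Eventually.of_forall (hB · s))).trans ?_
    filter_upwards [hκ.condExp_eq t ht s] with ω hω
    rw [Pi.mul_apply, hω, mul_comm]
  have hκG : ∀ s, Integrable (fun ω => κ t ω s * G ω s) P := fun s =>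
    integrable_condExp.congr (hpull s)
  have hsplit : ∀ ω, G ω (Z t ω) = ∑ s, ((G · s) * I s) ω := fun ω => by
    rw [eq_sum_indicator_eq (Z t) G]
    refine sum_congr rfl fun s _ => ?_
    by_cases h : Z t ω = s <;> simp [I, h]
  calc ∫ ω, G ω (Z t ω) ∂P = ∑ s, ∫ ω, ((G · s) * I s) ω ∂P := by
        simp_rw [hsplit]
        exact integral_finsetSum _ fun s _ => hGI s
    _ = ∑ s, ∫ ω, κ t ω s * G ω s ∂P := sum_congr rfl fun s _ => by
        rw [← integral_condExp (𝓕.le t)]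
        exact integral_congr_ae (hpull s)
    _ = ∫ ω, ∑ s, κ t ω s * G ω s ∂P := (integral_finsetSum _ fun s _ => hκG s).symm
    _ ≤ ∫ ω, W ω ∂P := integral_mono (integrable_finsetSum _ fun s _ => hκG s) hW hGW

namespace IsSupermartingaleFactor

theorem integrable_prod (hΦ : IsSupermartingaleFactor 𝓕 T κ Φ B) (hκ : HasCondLaw P 𝓕 T Z κ)
    {t : ℕ} (ht : t ≤ T) : Integrable (fun ω => ∏ i ∈ range t, Φ i ω (Z i ω)) P :=
  .of_bound ((hΦ.measurable_prod hκ t ht).mono (𝓕.le t) le_rfl).aestronglyMeasurable (B ^ t)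
    (Filter.Eventually.of_forall fun ω => by
      rw [Real.norm_eq_abs, abs_of_nonneg (hΦ.prod_nonneg ht ω)]
      exact hΦ.prod_le ht ω)

theorem integral_prod_le_one (hΦ : IsSupermartingaleFactor 𝓕 T κ Φ B)
    (hκ : HasCondLaw P 𝓕 T Z κ) : ∀ t ≤ T, ∫ ω, ∏ i ∈ range t, Φ i ω (Z i ω) ∂P ≤ 1
  | 0, _ => by simp
  | t + 1, ht => by
      have ht' : t ≤ T := by omega
      simp_rw [prod_range_succ]
      refine (hκ.integral_comp_le (B := B ^ t * B) ht
        (G := fun ω s => (∏ i ∈ range t, Φ i ω (Z i ω)) * Φ t ω s)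
        (fun s => (hΦ.measurable_prod hκ t ht').mul (hΦ.measurable t ht s)) (fun ω s => ?_)
        (hΦ.integrable_prod hκ ht') fun ω => ?_).trans (hΦ.integral_prod_le_one hκ t ht')
      · have hprod := hΦ.prod_nonneg (Z := Z) ht' ω
        rw [abs_of_nonneg (mul_nonneg hprod (hΦ.nonneg t ht ω s))]
        exact mul_le_mul (hΦ.prod_le ht' ω) (hΦ.le_bound t ht ω s) (hΦ.nonneg t ht ω s)
          (hprod.trans (hΦ.prod_le ht' ω))
      · simp_rw [mul_left_comm (κ t ω _)]
        rw [← mul_sum]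
        exact mul_le_of_le_one_right (hΦ.prod_nonneg ht' ω) (hΦ.sum_le_one t ht ω)

theorem measure_exp_le_prod_le (hΦ : IsSupermartingaleFactor 𝓕 T κ Φ B)
    (hκ : HasCondLaw P 𝓕 T Z κ) (c : ℝ) :
    P {ω | Real.exp c ≤ ∏ t ∈ range T, Φ t ω (Z t ω)} ≤ ENNReal.ofReal (Real.exp (-c)) := by
  have markov := (mul_meas_ge_le_integral_of_nonneg (μ := P)
    (Filter.Eventually.of_forall fun ω => hΦ.prod_nonneg (Z := Z) le_rfl ω)
    (hΦ.integrable_prod hκ le_rfl) (Real.exp c)).trans (hΦ.integral_prod_le_one hκ T le_rfl)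
  rw [← ENNReal.ofReal_toReal (measure_ne_top P _)]
  refine ENNReal.ofReal_le_ofReal ?_
  rwa [Real.exp_neg, ← one_div, le_div_iff₀' (Real.exp_pos c)]

end IsSupermartingaleFactor

/-- `ProbabilityTheory.measure_sum_ge_le_of_hasCondSubgaussianMGF` would require `Ω` to be standard
Borel. -/
theorem HasCondLaw.measure_sum_sub_le (hκ : HasCondLaw P 𝓕 T Z κ) {h : ℕ → Ω → S → ℝ} {C r : ℝ}
    (hr : 0 ≤ r) (hm : ∀ t < T, ∀ s, Measurable[𝓕 t] (h t · s))
    (hC : ∀ t < T, ∀ ω s, h t ω s ∈ Set.Icc 0 C) :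
    P {ω | r < ∑ t ∈ range T, (∑ s, κ t ω s * h t ω s - h t ω (Z t ω))} ≤
      ENNReal.ofReal (Real.exp (-(2 * r ^ 2 / (T * C ^ 2)))) := by
  set c : ℝ := 4 * r / (T * C ^ 2)
  have hc : 0 ≤ c := by positivity
  have hexponent : c * r - T * (c ^ 2 * C ^ 2 / 8) = 2 * r ^ 2 / (T * C ^ 2) := by
    rcases eq_or_ne (T * C ^ 2 : ℝ) 0 with h0 | h0
    · simp [c, h0]
    · have hT : (T : ℝ) ≠ 0 := left_ne_zero_of_mul h0
      have hC' : C ≠ 0 := by simpa using right_ne_zero_of_mul h0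
      simp only [c]
      field_simp
      ring
  rw [← hexponent]
  refine (measure_mono fun ω hω => ?_).trans
    ((hκ.isSupermartingaleFactor_exp hc hm hC).measure_exp_le_prod_le hκ _)
  rw [Set.mem_ofPred_eq, ← Real.exp_sum, sum_sub_distrib, ← mul_sum, sum_const, card_range,
    nsmul_eq_mul]
  exact Real.exp_le_exp.2 (sub_le_sub_right (mul_le_mul_of_nonneg_left (le_of_lt hω) hc) _)

end Concentration

section Trajectory

/-- The event that the sequence `Z` agrees with `y` at the indices in `I`. -/
def agreeSet {Ω S : Type*} (Z : Ω → ℕ → S) (I : Finset ℕ) (y : ℕ → S) : Set Ω :=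
  {ω | ∀ n ∈ I, Z ω n = y n}

theorem measurableSet_agreeSet {Ω S : Type*} [MeasurableSpace Ω] {Z : Ω → ℕ → S} {I : Finset ℕ}
    (hZ : ∀ n ∈ I, ∀ s, MeasurableSet {ω | Z ω n = s}) (y : ℕ → S) :
    MeasurableSet (agreeSet Z I y) := by
  have heq : agreeSet Z I y = ⋂ n ∈ I, {ω | Z ω n = y n} := by
    ext ω
    simp [agreeSet]
  rw [heq]
  exact I.measurableSet_biInter fun n hn => hZ n hn _

theorem indicator_agreeSet_eq_sum {Ω S : Type*} [Fintype S] (Z : Ω → ℕ → S) {I : Finset ℕ} {i : ℕ}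
    (hi : i ∉ I) (y : ℕ → S) :
    (agreeSet Z I y).indicator (fun _ => (1 : ℝ)) =
      ∑ s, (agreeSet Z (insert i I) (Function.update y i s)).indicator fun _ => (1 : ℝ) := by
  have hmem : ∀ ω s, ω ∈ agreeSet Z (insert i I) (Function.update y i s) ↔
      Z ω i = s ∧ ω ∈ agreeSet Z I y := fun ω s => by
    simp only [agreeSet, Set.mem_ofPred_eq, forall_mem_insert, Function.update_self]
    refine and_congr_right fun _ => forall₂_congr fun n hn => ?_
    rw [Function.update_of_ne (ne_of_mem_of_not_mem hn hi)]
  funext ω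
  rw [Finset.sum_apply, sum_eq_single (Z ω i) (fun s _ hs =>
    Set.indicator_of_notMem (fun h => hs ((hmem ω s).1 h).1.symm) _) (by simp)]
  exact Set.indicator_eq_indicator (by simp [hmem]) rfl

variable {X : Type u} {A : Type v}

theorem trajProb_succ_update (k : ℕ) (p : ℕ → X → A → X → ℝ) (π : ℕ → X → A → ℝ)
    (ν : X × A → ℝ) (y : ℕ → X × A) (v : X × A) :
    trajProb (k + 1) p π ν (Function.update y (k + 1) v) =
      trajProb k p π ν y * stepMatrix p π (k + 1) (y k) v := by
  unfold trajProb
  rw [prod_range_succ, ← mul_assoc, Function.update_self, Function.update_of_ne (by omega),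
    Function.update_of_ne (by omega)]
  congr 2
  refine prod_congr rfl fun n hn => ?_
  have := mem_range.1 hn
  rw [Function.update_of_ne (by omega), Function.update_of_ne (by omega)]

variable [Fintype X] [Fintype A]

theorem sum_stepMatrix_mul {N n : ℕ} (p : ℕ → X → A → X → ℝ) {π : ℕ → X → A → ℝ}
    (hπ : IsPolicy N π) (hn : n ∈ Icc 1 N) (y : X × A) (h : X → ℝ) :
    ∑ z, stepMatrix p π n y z * h z.1 = ∑ x, p n y.1 y.2 x * h x := by
  rw [Fintype.sum_prod_type]
  refine sum_congr rfl fun x _ => ?_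
  simp only [stepMatrix, Matrix.of_apply, mul_right_comm _ _ (h x)]
  rw [← mul_sum, (hπ n hn x).2, mul_one]

theorem stepMatrix_mem_stdSimplex {N n : ℕ} {p : ℕ → X → A → X → ℝ} {π : ℕ → X → A → ℝ}
    (hp : IsKernel N p) (hπ : IsPolicy N π) (hn : n ∈ Icc 1 N) (y : X × A) :
    stepMatrix p π n y ∈ stdSimplex ℝ (X × A) := by
  refine ⟨fun z => mul_nonneg ((hp n hn _ _).1 _) ((hπ n hn _).1 _), ?_⟩
  simpa only [mul_one, (hp n hn _ _).2] using sum_stepMatrix_mul p hπ hn y fun _ => 1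

variable {Ω : Type w} {m mΩ : MeasurableSpace Ω} {P : Measure Ω} [IsProbabilityMeasure P] {N : ℕ}
  {p : ℕ → X → A → X → ℝ} {Z : Ω → ℕ → X × A} {π : Ω → ℕ → X → A → ℝ} {ν : Ω → X × A → ℝ}

theorem condExp_agreeSet_eq_sum {I J : Finset ℕ} {i : ℕ} (hi : i ∉ I) (hJ : insert i I = J)
    (hZ : ∀ n ∈ J, ∀ y, MeasurableSet {ω | Z ω n = y}) {y : ℕ → X × A} {κ : X × A → Ω → ℝ}
    (hκ : ∀ v, P[(agreeSet Z J (Function.update y i v)).indicator (fun _ => (1 : ℝ)) | m]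
      =ᵐ[P] κ v) :
    P[(agreeSet Z I y).indicator (fun _ => (1 : ℝ)) | m] =ᵐ[P] fun ω => ∑ v, κ v ω := by
  subst hJ
  rw [indicator_agreeSet_eq_sum Z hi]
  refine (condExp_finsetSum (fun v _ => (integrable_const (1 : ℝ)).indicator
    (measurableSet_agreeSet hZ _)) m).trans ?_
  filter_upwards [ae_all_iff.2 hκ] with ω hω
  rw [Finset.sum_apply, sum_congr rfl fun v _ => hω v]

theorem condExp_agreeSet_Icc_zero (hp : IsKernel N p) (hπ : ∀ ω, IsPolicy N (π ω))
    (hZ : ∀ n ≤ N, ∀ y, MeasurableSet {ω | Z ω n = y})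
    (hlaw : ∀ y, P[(agreeSet Z (Icc 0 N) y).indicator (fun _ => (1 : ℝ)) | m] =ᵐ[P]
      fun ω => trajProb N p (π ω) (ν ω) y) {k : ℕ} (hk : k ≤ N) :
    ∀ y, P[(agreeSet Z (Icc 0 k) y).indicator (fun _ => (1 : ℝ)) | m] =ᵐ[P]
      fun ω => trajProb k p (π ω) (ν ω) y := by
  induction hk using Nat.decreasingInduction with
  | self => exact hlaw
  | of_succ k hk ih =>
    intro y
    have hsum := condExp_agreeSet_eq_sum (by simp) (insert_Icc_right_eq_Icc_add_one (Nat.zero_le _))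
      (fun n hn => hZ n ((mem_Icc.1 hn).2.trans hk)) fun v => ih (Function.update y (k + 1) v)
    refine hsum.trans (Filter.Eventually.of_forall fun ω => ?_)
    simp only [trajProb_succ_update]
    rw [← mul_sum, (stepMatrix_mem_stdSimplex hp (hπ ω) (succ_mem_Icc hk) _).2, mul_one]

theorem condExp_agreeSet_Icc (hp : IsKernel N p) (hπ : ∀ ω, IsPolicy N (π ω))
    (hZ : ∀ n ≤ N, ∀ y, MeasurableSet {ω | Z ω n = y})
    (hlaw : ∀ y, P[(agreeSet Z (Icc 0 N) y).indicator (fun _ => (1 : ℝ)) | m] =ᵐ[P]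
      fun ω => trajProb N p (π ω) (ν ω) y) {k : ℕ} (hk : k ≤ N) :
    ∀ j ≤ k, ∀ y, P[(agreeSet Z (Icc j k) y).indicator (fun _ => (1 : ℝ)) | m] =ᵐ[P]
      fun ω => occ p (π ω) (ν ω) j (y j) *
        ∏ n ∈ Ico j k, stepMatrix p (π ω) (n + 1) (y n) (y (n + 1))
  | 0, _, y => by
      simpa only [trajProb, occ, Nat.Ico_zero_eq_range] using
        condExp_agreeSet_Icc_zero hp hπ hZ hlaw hk y
  | j + 1, hj, y => by
      have hsum := condExp_agreeSet_eq_sum (by simp) (insert_Icc_add_one_left_eq_Icc (by omega))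
        (fun n hn => hZ n ((mem_Icc.1 hn).2.trans hk)) fun v =>
          condExp_agreeSet_Icc hp hπ hZ hlaw hk j (by omega) (Function.update y j v)
      refine hsum.trans (Filter.Eventually.of_forall fun ω => ?_)
      simp only
      rw [occ, sum_mul]
      refine sum_congr rfl fun v _ => ?_
      rw [prod_eq_prod_Ico_succ_bot (by omega), Function.update_self,
        Function.update_of_ne (by omega), ← mul_assoc]
      congr 1
      · simp [stepMatrix, mul_assoc]
      · refine prod_congr rfl fun n hn => ?_
        have := (mem_Ico.1 hn).1
        rw [Function.update_of_ne (by omega), Function.update_of_ne (by omega)]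

end Trajectory

section Interaction

theorem measurable_occ {X : Type u} {A : Type v} [Fintype X] [Fintype A] {Ω : Type w}
    {m : MeasurableSpace Ω} {N : ℕ} (p : ℕ → X → A → X → ℝ) {π : Ω → ℕ → X → A → ℝ}
    {ν : Ω → X × A → ℝ} (hπ : ∀ n ∈ Icc 1 N, ∀ x a, Measurable (π · n x a))
    (hν : ∀ y, Measurable (ν · y)) :
    ∀ n ≤ N, ∀ y, Measurable fun ω => occ p (π ω) (ν ω) n y
  | 0, _, y => hν y
  | n + 1, hn, y => measurable_fun_sum _ fun y' _ =>
      ((measurable_occ p hπ hν n (by omega) y').mul_const _).mul (hπ _ (succ_mem_Icc hn) _ _)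

variable {X : Type u} {A : Type v} [Fintype X] [Fintype A] [DecidableEq X] [DecidableEq A]
  {Ω : Type w} [mΩ : MeasurableSpace Ω]

/-- The protocol of `IsRun` without the learner: the policies `π t` are chosen from the past and
played without reset, and the trajectories `Y t` are observed. -/
structure IsInteraction (P : Measure Ω) (𝓕 : Filtration ℕ mΩ) (N T : ℕ) (p : ℕ → X → A → X → ℝ)
    (ρ : X × A → ℝ) (Y : ℕ → Ω → ℕ → X × A) (π : ℕ → Ω → ℕ → X → A → ℝ) : Prop where
  policy : ∀ t < T, ∀ ω, IsPolicy N (π t ω)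
  policy_adapted : ∀ t < T, ∀ n ∈ Icc 1 N, ∀ x a, Measurable[𝓕 t] (π t · n x a)
  traj_adapted : ∀ t < T, ∀ n ≤ N, ∀ y, MeasurableSet[𝓕 (t + 1)] {ω | Y t ω n = y}
  traj_law : ∀ t < T, ∀ y,
    P[(agreeSet (Y t) (Icc 0 N) y).indicator (fun _ => (1 : ℝ)) | 𝓕 t] =ᵐ[P]
      fun ω => trajProb N p (π t ω) (startDist N p ρ (π · ω) t) y

variable {P : Measure Ω} {𝓕 : Filtration ℕ mΩ} {N T : ℕ} {p : ℕ → X → A → X → ℝ}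
  {ρ : X × A → ℝ} {Y : ℕ → Ω → ℕ → X × A} {π : ℕ → Ω → ℕ → X → A → ℝ}

section IsRun

variable {α δ ℓ η : ℝ} {D : (Fin (N + 1) → X × A → ℝ) → (Fin (N + 1) → X × A → ℝ) → ℝ}
  {f : ℕ → Ω → ℕ → (X × A → ℝ) → ℝ} {g : ℕ → Ω → ℕ → X × A → ℝ}

theorem IsRun.isInteraction (hrun : IsRun P 𝓕 N T p ρ α δ ℓ η D f g Y π) :
    IsInteraction P 𝓕 N T p ρ Y π where
  policy := hrun.policy
  policy_adapted := hrun.policy_adapted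
  traj_adapted := hrun.traj_adapted
  traj_law t ht y := by simpa [agreeSet] using hrun.traj_law t ht y

theorem IsRun.abs_subgradient_le (hrun : IsRun P 𝓕 N T p ρ α δ ℓ η D f g Y π) :
    ∀ t < T, ∀ ω, ∀ n ∈ Icc 1 N, ∀ y, |g t ω n y| ≤ ℓ := fun t ht ω n hn =>
  abs_le_of_isSubgradient (hrun.loss_convex t ht ω n hn).2 (hrun.subgradient t ht ω n hn)

end IsRun

namespace IsInteraction

theorem measurable_startDist (hY : IsInteraction P 𝓕 N T p ρ Y π) :
    ∀ t ≤ T, ∀ y, Measurable[𝓕 t] fun ω => startDist N p ρ (π · ω) t y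
  | 0, _, _ => measurable_const
  | t + 1, ht, y => by
      simp_rw [startDist_succ]
      exact (measurable_occ p (hY.policy_adapted t ht) (hY.measurable_startDist t (by omega)) N
        le_rfl y).mono (𝓕.mono t.le_succ) le_rfl

theorem measurable_playedOcc (hY : IsInteraction P 𝓕 N T p ρ Y π) {t n : ℕ} (ht : t < T)
    (hn : n ≤ N) (y : X × A) : Measurable[𝓕 t] fun ω => playedOcc N p ρ (π · ω) t n y :=
  measurable_occ p (hY.policy_adapted t ht) (hY.measurable_startDist t ht.le) n hn y

theorem measurable_visits (hY : IsInteraction P 𝓕 N T p ρ Y π) {n : ℕ} (hn : n ≤ N) :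
    ∀ t ≤ T, ∀ y, Measurable[𝓕 t] fun ω => visits (Y · ω) t n y
  | 0, _, _ => by simp [visits]
  | t + 1, ht, y => by
      simp_rw [visits_succ]
      exact ((hY.measurable_visits hn t (by omega) y).mono (𝓕.mono t.le_succ) le_rfl).add
        (Measurable.ite (hY.traj_adapted t ht n hn y) measurable_const measurable_const)

theorem measurable_bonus (hY : IsInteraction P 𝓕 N T p ρ Y π) {t n : ℕ} (ht : t ≤ T) (hn : n ≤ N)
    (δ : ℝ) (y : X × A) : Measurable[𝓕 t] fun ω => bonus N T δ (Y · ω) t n y :=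
  (measurable_from_top (f := fun m : ℕ => bonusConst X A N T δ / √(max 1 (m : ℝ)))).comp
    (hY.measurable_visits hn t ht y)

variable [IsProbabilityMeasure P]

theorem condExp_agreeSet (hp : IsKernel N p) (hY : IsInteraction P 𝓕 N T p ρ Y π) {t j k : ℕ}
    (ht : t < T) (hjk : j ≤ k) (hk : k ≤ N) (y : ℕ → X × A) :
    P[(agreeSet (Y t) (Icc j k) y).indicator (fun _ => (1 : ℝ)) | 𝓕 t] =ᵐ[P]
      fun ω => playedOcc N p ρ (π · ω) t j (y j) *
        ∏ n ∈ Ico j k, stepMatrix p (π t ω) (n + 1) (y n) (y (n + 1)) :=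
  condExp_agreeSet_Icc hp (hY.policy t ht)
    (fun n hn y => 𝓕.le _ _ (hY.traj_adapted t ht n hn y)) (hY.traj_law t ht) hk j hjk y

theorem hasCondLaw_pair (hp : IsKernel N p) (hρ : ρ ∈ stdSimplex ℝ (X × A))
    (hY : IsInteraction P 𝓕 N T p ρ Y π) {n : ℕ} (hn : n ≤ N) :
    HasCondLaw P 𝓕 T (Y · · n) fun t ω => playedOcc N p ρ (π · ω) t n where
  measurableSet_eq t ht := hY.traj_adapted t ht n hn
  measurable_law _ ht := hY.measurable_playedOcc ht hn
  law_mem _ ht ω := playedOcc_mem_stdSimplex hp hρ (fun t ht => hY.policy t ht ω) ht hn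
  condExp_eq t ht y := by
    simpa [agreeSet] using hY.condExp_agreeSet hp ht le_rfl hn fun _ => y

theorem hasCondLaw_transition (hp : IsKernel N p) (hρ : ρ ∈ stdSimplex ℝ (X × A))
    (hY : IsInteraction P 𝓕 N T p ρ Y π) {n : ℕ} (hn : n < N) :
    HasCondLaw P 𝓕 T (fun t ω => (Y t ω n, Y t ω (n + 1))) fun t ω z =>
      playedOcc N p ρ (π · ω) t n z.1 * stepMatrix p (π t ω) (n + 1) z.1 z.2 where
  measurableSet_eq t ht z := by
    simp only [Prod.ext_iff (y := z)]
    exact (hY.traj_adapted t ht n hn.le z.1).inter (hY.traj_adapted t ht (n + 1) hn z.2)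
  measurable_law t ht z :=
    (hY.measurable_playedOcc ht hn.le z.1).mul
      ((hY.policy_adapted t ht _ (succ_mem_Icc hn) _ _).const_mul _)
  law_mem t ht ω := by
    have hocc := playedOcc_mem_stdSimplex hp hρ (fun t ht => hY.policy t ht ω) ht hn.le
    have hstep := stepMatrix_mem_stdSimplex hp (hY.policy t ht ω) (succ_mem_Icc hn)
    refine ⟨fun z => mul_nonneg (hocc.1 _) ((hstep _).1 _), ?_⟩
    rw [Fintype.sum_prod_type]
    simp only [← mul_sum, (hstep _).2, mul_one, hocc.2]
  condExp_eq t ht z := by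
    have h := hY.condExp_agreeSet hp ht n.le_succ hn fun i => if i = n then z.1 else z.2
    have hset : agreeSet (Y t) (Icc n (n + 1)) (fun i => if i = n then z.1 else z.2) =
        {ω | (Y t ω n, Y t ω (n + 1)) = z} := by
      ext ω
      simp [agreeSet, ← insert_Icc_add_one_left_eq_Icc n.le_succ, Prod.ext_iff]
    rw [hset] at h
    simpa using h

end IsInteraction

end Interaction

section ModelAccuracy

variable {X : Type u} {A : Type v} [Fintype X] [DecidableEq X]

/-- The vector of signs that is `1` on `S` and `-1` off `S`. -/
def signVec (S : Finset X) (x : X) : ℝ := if x ∈ S then 1 else -1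

omit [Fintype X] in
theorem abs_signVec (S : Finset X) (x : X) : |signVec S x| = 1 := by
  unfold signVec
  split_ifs <;> simp

theorem exists_sum_abs_eq_sum_signVec_mul (z : X → ℝ) :
    ∃ S, ∑ x, |z x| = ∑ x, signVec S x * z x := by
  refine ⟨univ.filter fun x => 0 ≤ z x, sum_congr rfl fun x _ => ?_⟩
  rcases le_or_gt 0 (z x) with h | h
  · simp [signVec, h, abs_of_nonneg]
  · simp [signVec, not_le.2 h, abs_of_neg h]

variable [DecidableEq A]

omit [Fintype X] in
theorem visits_mono (Y : ℕ → ℕ → X × A) (n : ℕ) (y : X × A) : Monotone (visits Y · n y) :=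
  fun _ _ h => card_le_card (filter_subset_filter _ (range_mono h))

omit [Fintype X] in
theorem visits_le (Y : ℕ → ℕ → X × A) (t n : ℕ) (y : X × A) : visits Y t n y ≤ t :=
  (card_filter_le _ _).trans_eq (card_range t)

/-- The sum, over the visits of `y` at step `n` before episode `t`, of the centred values of the
test function `s` at the next state. -/
def deviation (p : ℕ → X → A → X → ℝ) (s : X → ℝ) (Y : ℕ → ℕ → X × A) (t n : ℕ) (y : X × A) : ℝ :=
  ∑ i ∈ range t with Y i n = y, (s (Y i (n + 1)).1 - ∑ x, p (n + 1) y.1 y.2 x * s x)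

theorem deviation_succ (p : ℕ → X → A → X → ℝ) (s : X → ℝ) (Y : ℕ → ℕ → X × A) (t n : ℕ)
    (y : X × A) : deviation p s Y (t + 1) n y = deviation p s Y t n y +
      if Y t n = y then s (Y t (n + 1)).1 - ∑ x, p (n + 1) y.1 y.2 x * s x else 0 := by
  simp only [deviation, sum_filter, sum_range_succ]

theorem deviation_eq_sum_mul (p : ℕ → X → A → X → ℝ) (s : X → ℝ) (Y : ℕ → ℕ → X × A) (t n : ℕ)
    (y : X × A) : deviation p s Y t n y =
      ∑ x, s x * (transitions Y t n y x - visits Y t n y * p (n + 1) y.1 y.2 x) := by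
  have hobserved : ∑ i ∈ range t with Y i n = y, s (Y i (n + 1)).1 =
      ∑ x, s x * transitions Y t n y x := by
    rw [← sum_fiberwise']
    refine sum_congr rfl fun x _ => ?_
    rw [filter_filter, sum_const, nsmul_eq_mul, mul_comm, transitions]
  simp only [deviation, sum_sub_distrib, hobserved, sum_const, nsmul_eq_mul, mul_sub]
  rw [mul_sum]
  congr 1
  exact sum_congr rfl fun x _ => by rw [visits]; ring

theorem exists_visits_mul_sum_abs_eq_deviation (p : ℕ → X → A → X → ℝ) (Y : ℕ → ℕ → X × A)
    (t n : ℕ) {y : X × A} (hy : 0 < visits Y (t + 1) n y) :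
    ∃ S, visits Y (t + 1) n y *
      ∑ x, |p (n + 1) y.1 y.2 x - estKernel Y (t + 1) (n + 1) y.1 y.2 x| =
        deviation p (signVec S) Y (t + 1) n y := by
  obtain ⟨S, hS⟩ := exists_sum_abs_eq_sum_signVec_mul fun x =>
    (transitions Y (t + 1) n y x : ℝ) - visits Y (t + 1) n y * p (n + 1) y.1 y.2 x
  refine ⟨S, ?_⟩
  have hy' : (1 : ℝ) ≤ visits Y (t + 1) n y := by exact_mod_cast hy
  rw [deviation_eq_sum_mul, ← hS, mul_sum]
  refine sum_congr rfl fun x _ => ?_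
  rw [← abs_of_pos (zero_lt_one.trans_le hy'), ← abs_mul, abs_sub_comm _ (_ * _), mul_sub,
    abs_of_pos (zero_lt_one.trans_le hy')]
  simp [estKernel, max_eq_right hy', mul_div_cancel₀ _ (zero_lt_one.trans_le hy').ne']

theorem sum_abs_sub_estKernel_eq_one {N n : ℕ} {p : ℕ → X → A → X → ℝ} (hp : IsKernel N p)
    (hn : n < N) (Y : ℕ → ℕ → X × A) (t : ℕ) {y : X × A} (hy : visits Y (t + 1) n y = 0) :
    ∑ x, |p (n + 1) y.1 y.2 x - estKernel Y (t + 1) (n + 1) y.1 y.2 x| = 1 := by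
  have hpy := hp _ (succ_mem_Icc hn) y.1 y.2
  have htransitions : ∀ x, transitions Y (t + 1) n y x = 0 := fun x =>
    sum_eq_zero_iff.1 ((sum_transitions Y (t + 1) n y).trans hy) x (mem_univ x)
  rw [← hpy.2]
  exact sum_congr rfl fun x _ => by simp [estKernel, htransitions, abs_of_nonneg (hpy.1 x)]

theorem exists_deviation_of_not_modelAccurate [Fintype A] {N T : ℕ} {p : ℕ → X → A → X → ℝ} {δ : ℝ}
    {Y : ℕ → ℕ → X × A} (hp : IsKernel N p) (hC : 1 ≤ bonusConst X A N T δ)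
    (hY : ¬ModelAccurate N T p δ Y) :
    ∃ n < N, ∃ y S, ∃ t ≤ T, 0 < visits Y t n y ∧
      bonusConst X A N T δ * √(visits Y t n y : ℝ) ≤ deviation p (signVec S) Y t n y := by
  unfold ModelAccurate KernelDistLE at hY
  push Not at hY
  obtain ⟨t, ht, n, hn, y, hlt⟩ := hY
  rcases Nat.eq_zero_or_pos (visits Y (t + 1) n y) with hy | hy
  · rw [sum_abs_sub_estKernel_eq_one hp hn Y t hy] at hlt
    simp only [bonus, hy, Nat.cast_zero, zero_le_one, sup_of_le_left, Real.sqrt_one,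
      div_one] at hlt
    linarith
  · obtain ⟨S, hS⟩ := exists_visits_mul_sum_abs_eq_deviation p Y t n hy
    refine ⟨n, hn, y, S, t + 1, ht.le, hy, ?_⟩
    have hy' : (1 : ℝ) ≤ visits Y (t + 1) n y := by exact_mod_cast hy
    rw [bonus, max_eq_right hy'] at hlt
    rw [← hS]
    refine le_trans (le_of_eq ?_) (mul_le_mul_of_nonneg_left hlt.le (Nat.cast_nonneg _))
    rw [mul_div_left_comm, Real.div_sqrt]

/-- The exponential supermartingale of `deviation`, stopped after `m` visits of `y`, is the product
over the episodes of these factors; `z` is the pair of state-action pairs at steps `n`, `n + 1`. -/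
noncomputable def visitFactor (p : ℕ → X → A → X → ℝ) (s : X → ℝ) (ε : ℝ) (m n : ℕ) (y : X × A)
    (Y : ℕ → ℕ → X × A) (t : ℕ) (z : (X × A) × (X × A)) : ℝ :=
  if z.1 = y ∧ visits Y t n y < m then
    Real.exp (ε * (s z.2.1 - ∑ x, p (n + 1) y.1 y.2 x * s x) - ε ^ 2 / 2) else 1

theorem prod_visitFactor_of_visits_le (p : ℕ → X → A → X → ℝ) (s : X → ℝ) (ε : ℝ) {m n : ℕ}
    {y : X × A} {Y : ℕ → ℕ → X × A} : ∀ {t : ℕ}, visits Y t n y ≤ m →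
    ∏ i ∈ range t, visitFactor p s ε m n y Y i (Y i n, Y i (n + 1)) =
      Real.exp (ε * deviation p s Y t n y - visits Y t n y * (ε ^ 2 / 2))
  | 0, _ => by simp [visits, deviation]
  | t + 1, ht => by
      have hsucc := visits_succ Y t n y
      rw [prod_range_succ, prod_visitFactor_of_visits_le p s ε (by omega), deviation_succ, hsucc,
        visitFactor]
      by_cases hy : Y t n = y
      · rw [if_pos hy] at hsucc
        simp only [hy, true_and, if_true]
        rw [if_pos (by omega), ← Real.exp_add]
        congr 1
        push_cast
        ring
      · simp [hy]

theorem prod_visitFactor_visits (p : ℕ → X → A → X → ℝ) (s : X → ℝ) (ε : ℝ) (n : ℕ) (y : X × A)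
    (Y : ℕ → ℕ → X × A) {t T : ℕ} (htT : t ≤ T) :
    ∏ i ∈ range T, visitFactor p s ε (visits Y t n y) n y Y i (Y i n, Y i (n + 1)) =
      Real.exp (ε * deviation p s Y t n y - visits Y t n y * (ε ^ 2 / 2)) := by
  rw [← prod_visitFactor_of_visits_le p s ε le_rfl, ← prod_range_mul_prod_Ico _ htT]
  refine mul_eq_left₀ (prod_ne_zero_iff.2 fun i _ => ?_) |>.2
    (prod_eq_one fun i hi => if_neg fun h => ?_)
  · unfold visitFactor
    split_ifs <;> positivity
  exact (visits_mono Y n y (mem_Ico.1 hi).1).not_gt h.2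

variable [Fintype A]

omit [DecidableEq X] [DecidableEq A] in
theorem sum_stepMatrix_mul_exp_le_one {N n : ℕ} {p : ℕ → X → A → X → ℝ} {π : ℕ → X → A → ℝ}
    (hp : IsKernel N p) (hπ : IsPolicy N π) (hn : n ∈ Icc 1 N) {s : X → ℝ} (hs : ∀ x, |s x| ≤ 1)
    (ε : ℝ) (y : X × A) :
    ∑ z, stepMatrix p π n y z *
      Real.exp (ε * (s z.1 - ∑ x, p n y.1 y.2 x * s x) - ε ^ 2 / 2) ≤ 1 := by
  rw [sum_stepMatrix_mul p hπ hn y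
    fun x => Real.exp (ε * (s x - ∑ x, p n y.1 y.2 x * s x) - ε ^ 2 / 2)]
  simp_rw [Real.exp_sub _ (ε ^ 2 / 2), ← mul_div_assoc]
  rw [← sum_div, div_le_one (Real.exp_pos _)]
  exact (sum_mul_exp_mul_sub_le (hp n hn y.1 y.2) (fun x => abs_le.1 (hs x)) ε).trans_eq
    (congrArg Real.exp (by ring))

omit [Fintype A] in
theorem visitFactor_le {N n : ℕ} {p : ℕ → X → A → X → ℝ} (hp : IsKernel N p) (hn : n < N)
    {s : X → ℝ} (hs : ∀ x, |s x| ≤ 1) {ε : ℝ} (hε : 0 ≤ ε) (m : ℕ) (y : X × A)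
    (Y : ℕ → ℕ → X × A) (t : ℕ) (z : (X × A) × (X × A)) :
    visitFactor p s ε m n y Y t z ≤ Real.exp (2 * ε) := by
  have hpy := hp _ (succ_mem_Icc hn) y.1 y.2
  have hmean : -1 ≤ ∑ x, p (n + 1) y.1 y.2 x * s x :=
    calc (-1 : ℝ) = ∑ x, p (n + 1) y.1 y.2 x * (-1) := by rw [← sum_mul, hpy.2, one_mul]
      _ ≤ _ := sum_le_sum fun x _ => mul_le_mul_of_nonneg_left (abs_le.1 (hs x)).1 (hpy.1 x)
  unfold visitFactor
  split_ifs
  · refine Real.exp_le_exp.2 ((sub_le_self _ (by positivity)).trans ?_)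
    rw [mul_comm 2]
    exact mul_le_mul_of_nonneg_left (by linarith [(abs_le.1 (hs z.2.1)).2]) hε
  · exact Real.one_le_exp (by linarith)

namespace IsInteraction

variable {Ω : Type w} [mΩ : MeasurableSpace Ω] {P : Measure Ω} {𝓕 : Filtration ℕ mΩ} {N T : ℕ}
  {p : ℕ → X → A → X → ℝ} {ρ : X × A → ℝ} {Y : ℕ → Ω → ℕ → X × A} {π : ℕ → Ω → ℕ → X → A → ℝ}
  {n : ℕ} {s : X → ℝ}

theorem isSupermartingaleFactor_visitFactor (hp : IsKernel N p) (hρ : ρ ∈ stdSimplex ℝ (X × A))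
    (hY : IsInteraction P 𝓕 N T p ρ Y π) (hn : n < N) (hs : ∀ x, |s x| ≤ 1) {ε : ℝ} (hε : 0 ≤ ε)
    (m : ℕ) (y : X × A) :
    IsSupermartingaleFactor 𝓕 T
      (fun t ω z => playedOcc N p ρ (π · ω) t n z.1 * stepMatrix p (π t ω) (n + 1) z.1 z.2)
      (fun t ω z => visitFactor p s ε m n y (Y · ω) t z) (Real.exp (2 * ε)) where
  measurable t ht z :=
    Measurable.ite ((MeasurableSet.const _).inter (hY.measurable_visits hn.le t ht.le y
      (MeasurableSet.of_discrete (s := Set.Iio m)))) measurable_const measurable_const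
  nonneg t _ ω z := by
    unfold visitFactor
    split_ifs <;> positivity
  le_bound t _ ω z := visitFactor_le hp hn hs hε m y _ t z
  sum_le_one t ht ω := by
    have hocc := playedOcc_mem_stdSimplex hp hρ (fun t ht => hY.policy t ht ω) ht hn.le
    have hπ := hY.policy t ht ω
    rw [Fintype.sum_prod_type, ← hocc.2]
    refine sum_le_sum fun y' _ => ?_
    simp_rw [mul_assoc]
    rw [← mul_sum]
    refine mul_le_of_le_one_right (hocc.1 y') ?_
    by_cases h : y' = y ∧ visits (Y · ω) t n y < m
    · simp only [visitFactor, h, and_self, if_true]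
      exact sum_stepMatrix_mul_exp_le_one hp hπ (succ_mem_Icc hn) hs ε y
    · simp only [visitFactor, h, if_false, mul_one]
      exact (stepMatrix_mem_stdSimplex hp hπ (succ_mem_Icc hn) y').2.le

variable [IsProbabilityMeasure P]

theorem measure_exists_le_deviation_le (hp : IsKernel N p) (hρ : ρ ∈ stdSimplex ℝ (X × A))
    (hY : IsInteraction P 𝓕 N T p ρ Y π) (hn : n < N) (hs : ∀ x, |s x| ≤ 1) {c : ℝ} (hc : 0 ≤ c)
    {m : ℕ} (hm : 0 < m) (y : X × A) :
    P {ω | ∃ t ≤ T, visits (Y · ω) t n y = m ∧ c * √(m : ℝ) ≤ deviation p s (Y · ω) t n y} ≤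
      ENNReal.ofReal (Real.exp (-(c ^ 2 / 2))) := by
  refine (measure_mono ?_).trans ((hY.isSupermartingaleFactor_visitFactor hp hρ hn hs
    (show 0 ≤ c / √(m : ℝ) by positivity) m y).measure_exp_le_prod_le
      (hY.hasCondLaw_transition hp hρ hn) (c ^ 2 / 2))
  rintro ω ⟨t, ht, rfl, hdev⟩
  rw [Set.mem_ofPred_eq, prod_visitFactor_visits p s _ n y _ ht, Real.exp_le_exp]
  have hpos : (0 : ℝ) < visits (Y · ω) t n y := by exact_mod_cast hm
  have hlinear := mul_le_mul_of_nonneg_left hdev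
    (show 0 ≤ c / √(visits (Y · ω) t n y : ℝ) by positivity)
  have hsq : c / √(visits (Y · ω) t n y : ℝ) * (c * √(visits (Y · ω) t n y : ℝ)) = c ^ 2 := by
    field_simp
  have hquad : visits (Y · ω) t n y * ((c / √(visits (Y · ω) t n y : ℝ)) ^ 2 / 2) = c ^ 2 / 2 := by
    rw [div_pow, Real.sq_sqrt hpos.le]
    field_simp
  linarith

theorem measure_not_modelAccurate_le (hp : IsKernel N p) (hρ : ρ ∈ stdSimplex ℝ (X × A))
    (hY : IsInteraction P 𝓕 N T p ρ Y π) {δ : ℝ} (hC : 1 ≤ bonusConst X A N T δ) :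
    P {ω | ¬ModelAccurate N T p δ (Y · ω)} ≤
      ENNReal.ofReal ((Fintype.card X : ℝ) * Fintype.card A * N * T * 2 ^ Fintype.card X *
        Real.exp (-(bonusConst X A N T δ ^ 2 / 2))) := by
  let E : Fin N × (X × A) × Finset X × Fin T → Set Ω := fun i =>
    {ω | ∃ t ≤ T, visits (Y · ω) t i.1 i.2.1 = (i.2.2.2 : ℕ) + 1 ∧
      bonusConst X A N T δ * √(((i.2.2.2 : ℕ) + 1 : ℕ) : ℝ) ≤
        deviation p (signVec i.2.2.1) (Y · ω) t i.1 i.2.1}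
  have hcover : {ω | ¬ModelAccurate N T p δ (Y · ω)} ⊆ ⋃ i, E i := fun ω hω => by
    obtain ⟨n, hn, y, S, t, ht, hpos, hdev⟩ := exists_deviation_of_not_modelAccurate hp hC hω
    have hvisits := visits_le (Y · ω) t n y
    have hsub : visits (Y · ω) t n y - 1 + 1 = visits (Y · ω) t n y := by omega
    refine Set.mem_iUnion.2 ⟨(⟨n, hn⟩, y, S, ⟨visits (Y · ω) t n y - 1, by omega⟩), t, ht, ?_⟩
    simpa only [hsub, true_and] using hdev
  refine (measure_mono hcover).trans ((measure_iUnion_fintype_le P E).trans ?_)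
  refine (sum_le_card_nsmul _ _ _ fun i _ => hY.measure_exists_le_deviation_le hp hρ i.1.2
    (fun x => (abs_signVec _ x).le) (bonusConst_nonneg X A N T δ) (Nat.succ_pos _) _).trans_eq ?_
  rw [nsmul_eq_mul, ← ENNReal.ofReal_natCast, ← ENNReal.ofReal_mul (Nat.cast_nonneg _)]
  congr 1
  simp only [card_univ, Fintype.card_prod, Fintype.card_fin, Fintype.card_finset]
  push_cast
  ring

theorem measure_exists_lt_bonusExcess_le (hp : IsKernel N p) (hρ : ρ ∈ stdSimplex ℝ (X × A))
    (hY : IsInteraction P 𝓕 N T p ρ Y π) {δ r : ℝ} (hr : 0 ≤ r) :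
    P {ω | ∃ n < N, r < bonusExcess N T p ρ δ (Y · ω) (π · ω) n} ≤ ENNReal.ofReal
      (N * Real.exp (-(2 * r ^ 2 / (T * bonusConst X A N T δ ^ 2)))) := by
  let E : Fin N → Set Ω := fun n => {ω | r < bonusExcess N T p ρ δ (Y · ω) (π · ω) n}
  have hcover : {ω | ∃ n < N, r < bonusExcess N T p ρ δ (Y · ω) (π · ω) n} ⊆ ⋃ n, E n :=
    fun ω ⟨n, hn, hω⟩ => Set.mem_iUnion.2 ⟨⟨n, hn⟩, hω⟩
  refine (measure_mono hcover).trans ((measure_iUnion_fintype_le P E).trans ?_)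
  have htail : ∀ n : Fin N, P (E n) ≤
      ENNReal.ofReal (Real.exp (-(2 * r ^ 2 / (T * bonusConst X A N T δ ^ 2)))) := fun n =>
    (hY.hasCondLaw_pair hp hρ n.2.le).measure_sum_sub_le hr
      (fun t ht y => hY.measurable_bonus ht.le n.2.le δ y)
      fun t _ ω y => ⟨bonus_nonneg N T δ _ t n y, bonus_le N T δ _ t n y⟩
  refine (sum_le_card_nsmul _ _ _ fun n _ => htail n).trans_eq ?_
  rw [nsmul_eq_mul, ← ENNReal.ofReal_natCast, ← ENNReal.ofReal_mul (Nat.cast_nonneg _)]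
  simp

end IsInteraction

end ModelAccuracy

section HighProbability

/-- The size `|X| |A| N T` of the problem. -/
def problemSize (X : Type u) (A : Type v) [Fintype X] [Fintype A] (N T : ℕ) : ℝ :=
  (Fintype.card X : ℝ) * Fintype.card A * N * T

/-- The logarithm in `bonusConst` and in the regret bound. -/
noncomputable def logFactor (X : Type u) (A : Type v) [Fintype X] [Fintype A] (N T : ℕ)
    (δ : ℝ) : ℝ :=
  Real.log (problemSize X A N T / δ)

/-- The level which, outside an event of probability at most `δ`, no `bonusExcess` exceeds. -/
noncomputable def excessLevel (X : Type u) (A : Type v) [Fintype X] [Fintype A] (N T : ℕ)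
    (δ : ℝ) : ℝ :=
  bonusConst X A N T δ * √(T * logFactor X A N T δ / 2)

variable {X : Type u} {A : Type v} [Fintype X] [Fintype A] {N T : ℕ} {δ : ℝ}

theorem bonusConst_sq (hL : 0 ≤ logFactor X A N T δ) :
    bonusConst X A N T δ ^ 2 = 2 * Fintype.card X * logFactor X A N T δ :=
  Real.sq_sqrt (mul_nonneg (by positivity) hL)

theorem excessLevel_nonneg : 0 ≤ excessLevel X A N T δ :=
  mul_nonneg (bonusConst_nonneg X A N T δ) (Real.sqrt_nonneg _)

theorem exp_neg_logFactor (hK : 0 < problemSize X A N T) (hδ : 0 < δ) :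
    Real.exp (-logFactor X A N T δ) = δ / problemSize X A N T := by
  rw [Real.exp_neg, logFactor, Real.exp_log (div_pos hK hδ), inv_div]

theorem one_le_bonusConst [Nonempty X] (hL : 1 ≤ logFactor X A N T δ) :
    1 ≤ bonusConst X A N T δ := by
  have hX : (1 : ℝ) ≤ Fintype.card X := by exact_mod_cast Fintype.card_pos
  exact Real.one_le_sqrt.2 (one_le_mul_of_one_le_of_one_le (by linarith) hL)

variable [Nonempty X] [Nonempty A]

theorem natCast_le_problemSize (hT : 1 ≤ T) : (N : ℝ) ≤ problemSize X A N T := by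
  have hK : N ≤ Fintype.card X * Fintype.card A * N * T :=
    (Nat.le_mul_of_pos_left N (Nat.mul_pos Fintype.card_pos Fintype.card_pos)).trans
      (Nat.le_mul_of_pos_right _ hT)
  unfold problemSize
  exact_mod_cast hK

theorem one_le_problemSize (hN : 1 ≤ N) (hT : 1 ≤ T) : 1 ≤ problemSize X A N T :=
  (by exact_mod_cast hN : (1 : ℝ) ≤ N).trans (natCast_le_problemSize hT)

theorem one_le_logFactor (hN : 1 ≤ N) (hT : 1 ≤ T) (hδ : 0 < δ) (hδ3 : 3 * δ ≤ 1) :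
    1 ≤ logFactor X A N T δ := by
  have hratio : 3 ≤ problemSize X A N T / δ :=
    (le_div_iff₀ hδ).2 (hδ3.trans (one_le_problemSize hN hT))
  rw [logFactor, Real.le_log_iff_exp_le (by linarith)]
  linarith [Real.exp_one_lt_three]

theorem problemSize_mul_two_pow_mul_exp_le (hN : 1 ≤ N) (hT : 1 ≤ T) (hδ : 0 < δ)
    (hδ3 : 3 * δ ≤ 1) :
    problemSize X A N T * 2 ^ Fintype.card X * Real.exp (-(bonusConst X A N T δ ^ 2 / 2)) ≤
      2 * δ := by
  have hK : 0 < problemSize X A N T := zero_lt_one.trans_le (one_le_problemSize hN hT)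
  have hratio : 2 * δ / problemSize X A N T ≤ 1 :=
    (div_le_one hK).2 (by linarith [one_le_problemSize (X := X) (A := A) hN hT])
  have hexponent : -(bonusConst X A N T δ ^ 2 / 2) = Fintype.card X * -logFactor X A N T δ := by
    rw [bonusConst_sq (zero_le_one.trans (one_le_logFactor hN hT hδ hδ3))]
    ring
  calc problemSize X A N T * 2 ^ Fintype.card X * Real.exp (-(bonusConst X A N T δ ^ 2 / 2))
      = problemSize X A N T * (2 * δ / problemSize X A N T) ^ Fintype.card X := by
        rw [hexponent, Real.exp_nat_mul, exp_neg_logFactor hK hδ, mul_assoc, ← mul_pow,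
          mul_div_assoc]
    _ ≤ problemSize X A N T * (2 * δ / problemSize X A N T) :=
        mul_le_mul_of_nonneg_left
          (pow_le_of_le_one (by positivity) hratio Fintype.card_ne_zero) hK.le
    _ = 2 * δ := mul_div_cancel₀ _ hK.ne'

theorem mul_exp_excessLevel_le (hN : 1 ≤ N) (hT : 1 ≤ T) (hδ : 0 < δ) (hδ3 : 3 * δ ≤ 1) :
    N * Real.exp (-(2 * excessLevel X A N T δ ^ 2 / (T * bonusConst X A N T δ ^ 2))) ≤ δ := by
  have hK : 0 < problemSize X A N T := zero_lt_one.trans_le (one_le_problemSize hN hT)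
  have : (0 : ℝ) < T := by exact_mod_cast hT
  have hL := one_le_logFactor (X := X) (A := A) hN hT hδ hδ3
  have hC := zero_lt_one.trans_le (one_le_bonusConst hL)
  have hexponent : 2 * excessLevel X A N T δ ^ 2 / (T * bonusConst X A N T δ ^ 2) =
      logFactor X A N T δ := by
    rw [excessLevel, mul_pow, Real.sq_sqrt (by positivity)]
    field_simp
  rw [hexponent, exp_neg_logFactor hK hδ, mul_div_left_comm]
  exact mul_le_of_le_one_right hδ.le ((div_le_one hK).2 (natCast_le_problemSize hT))

theorem mul_sqrt_le_of_sq_eq {x a T L C : ℝ} (hx : 0 ≤ x) (haT : 0 ≤ a * T) (hL : 1 ≤ L)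
    (hC : 0 ≤ C) (hCsq : C ^ 2 = 2 * x * L) : C * √(x * a * T) ≤ 2 * L * x * √(a * T) := by
  rw [mul_assoc x, ← sq_le_sq₀ (by positivity) (by positivity), mul_pow, mul_pow, hCsq,
    Real.sq_sqrt (by positivity), Real.sq_sqrt haT]
  calc 2 * x * L * (x * (a * T)) = 1 * (2 * L * x ^ 2 * (a * T)) := by ring
    _ ≤ 2 * L * (2 * L * x ^ 2 * (a * T)) :=
        mul_le_mul_of_nonneg_right (by linarith) (by positivity)
    _ = (2 * L * x) ^ 2 * (a * T) := by ring

theorem regret_const_le {x a T N L ℓ c C : ℝ} (hx : 1 ≤ x) (ha : 1 ≤ a) (hT : 0 ≤ T) (hN : 1 ≤ N)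
    (hL : 1 ≤ L) (hℓ : 0 ≤ ℓ) (hc : 0 ≤ c) (hC : 1 ≤ C) (hCsq : C ^ 2 = 2 * x * L) :
    N * (ℓ * (1 + N * C)) *
        (c * (2 * (1 + N * C) * (N * (3 * C * √(x * a * T) + C * √(T * L / 2))))) ≤
      128 * c * ℓ * N ^ 4 * x ^ 2 * √(a * T) * L ^ 3 := by
  have hNC : 1 + N * C ≤ 2 * N * C := by linarith [one_le_mul_of_one_le_of_one_le hN hC]
  have hexcess : √(T * L / 2) ≤ L * √(x * a * T) := by
    have hLL : L / 2 ≤ L ^ 2 := by nlinarith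
    have hTT : T ≤ x * a * T := le_mul_of_one_le_left hT (one_le_mul_of_one_le_of_one_le hx ha)
    refine Real.sqrt_le_iff.2 ⟨by positivity, ?_⟩
    rw [mul_pow, Real.sq_sqrt (by positivity)]
    calc T * L / 2 = L / 2 * T := by ring
      _ ≤ L ^ 2 * (x * a * T) := mul_le_mul hLL hTT hT (sq_nonneg L)
  have hpath : 3 * C * √(x * a * T) + C * √(T * L / 2) ≤ 4 * L * (C * √(x * a * T)) := by
    have hcollected : C * √(x * a * T) ≤ L * (C * √(x * a * T)) :=
      le_mul_of_one_le_left (by positivity) hL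
    linarith [mul_le_mul_of_nonneg_left hexcess (zero_le_one.trans hC)]
  calc N * (ℓ * (1 + N * C)) *
        (c * (2 * (1 + N * C) * (N * (3 * C * √(x * a * T) + C * √(T * L / 2)))))
      ≤ N * (ℓ * (2 * N * C)) * (c * (2 * (2 * N * C) * (N * (4 * L * (C * √(x * a * T)))))) := by
        gcongr
    _ = 32 * c * ℓ * N ^ 4 * L * C ^ 2 * (C * √(x * a * T)) := by ring
    _ ≤ 32 * c * ℓ * N ^ 4 * L * C ^ 2 * (2 * L * x * √(a * T)) := by
        refine mul_le_mul_of_nonneg_left ?_ (by positivity)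
        exact mul_sqrt_le_of_sq_eq (by linarith) (by positivity) hL (by linarith) hCsq
    _ = 128 * c * ℓ * N ^ 4 * x ^ 2 * √(a * T) * L ^ 3 := by
        rw [hCsq]
        ring

variable [DecidableEq X] [DecidableEq A] {p : ℕ → X → A → X → ℝ} {ρ : X × A → ℝ} {α ℓ : ℝ}

theorem diffRegret_le_of_modelAccurate {Y : ℕ → ℕ → X × A} {π : ℕ → ℕ → X → A → ℝ}
    {πc : ℕ → X → A → ℝ} {g : ℕ → ℕ → X × A → ℝ} (hN : 1 ≤ N) (hT : 1 ≤ T) (hp : IsKernel N p)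
    (hρ : ρ ∈ stdSimplex ℝ (X × A)) (hπ : ∀ t < T, IsPolicy N (π t)) (hπc : IsPolicy N πc)
    (hα : α < 1) (hL : 1 ≤ logFactor X A N T δ)
    (hg : ∀ t < T, ∀ n ∈ Icc 1 N, ∀ y, |g t n y| ≤ ℓ) (hM : ModelAccurate N T p δ Y)
    (hexcess : ∀ n < N, bonusExcess N T p ρ δ Y π n ≤ excessLevel X A N T δ)
    (hfeas : ∀ t, t + 1 < T → occ (estKernel Y (t + 1)) (π (t + 1)) (startDist N p ρ π (t + 1)) ∈
      episodeFeasibleSet N T p ρ α δ Y π (t + 1)) :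
    diffRegret N T p ρ δ ℓ g Y π πc ≤
      128 * (1 - α)⁻¹ * ℓ * (N : ℝ) ^ 4 * (Fintype.card X : ℝ) ^ 2 *
        √((Fintype.card A : ℝ) * T) * logFactor X A N T δ ^ 3 := by
  have hC := one_le_bonusConst hL
  have hℓ : 0 ≤ ℓ := (abs_nonneg _).trans
    (hg 0 hT 1 (mem_Icc.2 ⟨le_rfl, hN⟩) (Classical.arbitrary _))
  calc diffRegret N T p ρ δ ℓ g Y π πc
      ≤ N * (ℓ * (1 + N * bonusConst X A N T δ)) *
          ∑ t ∈ range T, l1 (startDist N p ρ π t - ρ) := diffRegret_le hℓ hg hπc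
    _ ≤ _ := by
        gcongr
        exact sum_l1_startDist_sub_le hN hp hρ hπ hα hC hM hexcess hfeas
    _ ≤ _ := regret_const_le (by exact_mod_cast Fintype.card_pos)
        (by exact_mod_cast Fintype.card_pos) T.cast_nonneg (by exact_mod_cast hN) hL hℓ
        (inv_nonneg.2 (by linarith)) hC (bonusConst_sq (by linarith))

theorem IsInteraction.measure_not_modelAccurate_union_le {Ω : Type w} [mΩ : MeasurableSpace Ω]
    {P : Measure Ω} [IsProbabilityMeasure P] {𝓕 : Filtration ℕ mΩ} {Y : ℕ → Ω → ℕ → X × A}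
    {π : ℕ → Ω → ℕ → X → A → ℝ} (hY : IsInteraction P 𝓕 N T p ρ Y π) (hN : 1 ≤ N) (hT : 1 ≤ T)
    (hp : IsKernel N p) (hρ : ρ ∈ stdSimplex ℝ (X × A)) (hδ : 0 < δ) (hδ3 : 3 * δ ≤ 1) :
    P ({ω | ¬ModelAccurate N T p δ (Y · ω)} ∪
        {ω | ∃ n < N, excessLevel X A N T δ < bonusExcess N T p ρ δ (Y · ω) (π · ω) n}) ≤
      ENNReal.ofReal (3 * δ) := by
  have hC := one_le_bonusConst (one_le_logFactor (X := X) (A := A) hN hT hδ hδ3)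
  calc _ ≤ _ := measure_union_le _ _
    _ ≤ ENNReal.ofReal (2 * δ) + ENNReal.ofReal δ := add_le_add
        ((hY.measure_not_modelAccurate_le hp hρ hC).trans
          (ENNReal.ofReal_le_ofReal (problemSize_mul_two_pow_mul_exp_le hN hT hδ hδ3)))
        ((hY.measure_exists_lt_bonusExcess_le hp hρ excessLevel_nonneg).trans
          (ENNReal.ofReal_le_ofReal (mul_exp_excessLevel_le hN hT hδ hδ3)))
    _ = ENNReal.ofReal (3 * δ) := by
        rw [← ENNReal.ofReal_add (by positivity) hδ.le]
        congr 1
        ring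

end HighProbability

end PeriodicMDP

theorem mainTheorem6_general {X : Type u} {A : Type v} [Fintype X] [Fintype A] [DecidableEq X]
    [DecidableEq A] {N T : ℕ} (hN : 1 ≤ N) (hT : 1 ≤ T) {p : ℕ → X → A → X → ℝ}
    (hp : PeriodicMDP.IsKernel N p) {ρ : X × A → ℝ} (hρ : ρ ∈ stdSimplex ℝ (X × A)) {α δ ℓ : ℝ}
    (hα : α < 1)
    (hcontr : ∃ πs, PeriodicMDP.IsPolicy N πs ∧ PeriodicMDP.ContractsTo N p ρ α πs) (hδ : 0 < δ)
    {Ω : Type w} [mΩ : MeasurableSpace Ω] {P : Measure Ω} [IsProbabilityMeasure P]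
    {𝓕 : Filtration ℕ mΩ} {g : ℕ → Ω → ℕ → X × A → ℝ} {Y : ℕ → Ω → ℕ → X × A}
    {π : ℕ → Ω → ℕ → X → A → ℝ} (hY : PeriodicMDP.IsInteraction P 𝓕 N T p ρ Y π)
    (hg : ∀ t < T, ∀ ω, ∀ n ∈ Finset.Icc 1 N, ∀ y, |g t ω n y| ≤ ℓ)
    (hplay : ∀ t, t + 1 < T → ∀ ω,
      (PeriodicMDP.episodeFeasibleSet N T p ρ α δ (Y · ω) (π · ω) (t + 1)).Nonempty →
        PeriodicMDP.occ (PeriodicMDP.estKernel (Y · ω) (t + 1)) (π (t + 1) ω)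
            (PeriodicMDP.startDist N p ρ (π · ω) (t + 1)) ∈
          PeriodicMDP.episodeFeasibleSet N T p ρ α δ (Y · ω) (π · ω) (t + 1)) :
    P {ω | ∃ πc, PeriodicMDP.IsPolicy N πc ∧
        128 * (1 - α)⁻¹ * ℓ * (N : ℝ) ^ 4 * (Fintype.card X : ℝ) ^ 2
            * √((Fintype.card A : ℝ) * T)
            * Real.log ((Fintype.card X : ℝ) * Fintype.card A * N * T / δ) ^ 3
          < PeriodicMDP.diffRegret N T p ρ δ ℓ (g · ω) (Y · ω) (π · ω) πc} ≤
      ENNReal.ofReal (3 * δ) := by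
  rcases le_total 1 (3 * δ) with hδ3 | hδ3
  · exact prob_le_one.trans (ENNReal.one_le_ofReal.2 hδ3)
  have : Nonempty (X × A) := not_isEmpty_iff.1 fun _ => by simpa using hρ.2
  have : Nonempty X := ‹Nonempty (X × A)›.map Prod.fst
  have : Nonempty A := ‹Nonempty (X × A)›.map Prod.snd
  refine (measure_mono ?_).trans (hY.measure_not_modelAccurate_union_le hN hT hp hρ hδ hδ3)
  rintro ω ⟨πc, hπc, hlt⟩
  by_contra hgood
  obtain ⟨hM, hexcess⟩ := not_or.1 hgood
  replace hM := not_not.1 hM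
  have hπ : ∀ t < T, PeriodicMDP.IsPolicy N (π t ω) := fun t ht => hY.policy t ht ω
  exact hlt.not_ge (PeriodicMDP.diffRegret_le_of_modelAccurate hN hT hp hρ hπ hπc hα
    (PeriodicMDP.one_le_logFactor hN hT hδ hδ3) (fun t ht => hg t ht ω) hM
    (fun n hn => not_lt.1 fun h => hexcess ⟨n, hn, h⟩) fun t ht =>
      hplay t ht ω (PeriodicMDP.episodeFeasibleSet_nonempty hp hρ hπ hM hcontr ht))

theorem mainTheorem6 :
    ∃ (C : ℝ) (k : ℕ), 0 < C ∧
      ∀ (X : Type u) (A : Type v) [Fintype X] [Fintype A] [DecidableEq X] [DecidableEq A]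
        (N T : ℕ) (_ : 1 ≤ N) (_ : 1 ≤ T)
        (p : ℕ → X → A → X → ℝ) (_ : PeriodicMDP.IsKernel N p)
        (ρ : X × A → ℝ) (_ : ρ ∈ stdSimplex ℝ (X × A))
        (α : ℝ) (_ : 0 ≤ α) (_ : α < 1)
        (_ : ∃ π, PeriodicMDP.IsPeriodic N p ρ π)
        (_ : PeriodicMDP.PeriodicContraction N p ρ α)
        (δ : ℝ) (_ : 0 < δ) (_ : δ < 1) (ℓ η : ℝ) (_ : 0 < η)
        (ψ : (Fin (N + 1) → X × A → ℝ) → ℝ)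
        (D : (Fin (N + 1) → X × A → ℝ) → (Fin (N + 1) → X × A → ℝ) → ℝ)
        (_ : PeriodicMDP.IsBregmanDivergence N ψ D)
        (Ω : Type w) [mΩ : MeasurableSpace Ω] (P : Measure Ω) [IsProbabilityMeasure P]
        (𝓕 : Filtration ℕ mΩ)
        (f : ℕ → Ω → ℕ → (X × A → ℝ) → ℝ) (g : ℕ → Ω → ℕ → X × A → ℝ)
        (Y : ℕ → Ω → ℕ → X × A) (π : ℕ → Ω → ℕ → X → A → ℝ)
        (_ : PeriodicMDP.IsRun P 𝓕 N T p ρ α δ ℓ η D f g Y π),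
        P {ω | ∃ πc, PeriodicMDP.IsPeriodic N p ρ πc ∧
            C * (1 - α)⁻¹ * ℓ * (N : ℝ) ^ 4 * (Fintype.card X : ℝ) ^ 2
                * √((Fintype.card A : ℝ) * T)
                * Real.log ((Fintype.card X : ℝ) * Fintype.card A * N * T / δ) ^ k
              < PeriodicMDP.diffRegret N T p ρ δ ℓ (fun t => g t ω) (fun t => Y t ω)
                  (fun t => π t ω) πc}
          ≤ ENNReal.ofReal (3 * δ) := by
  refine ⟨128, 3, by norm_num, ?_⟩
  intro X A _ _ _ _ N T hN hT p hp ρ hρ α _ hα ⟨πs, hπs⟩ hcontr δ hδ _ ℓ η _ ψ D _ Ω _ P _ 𝓕 f g Y π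
    hrun
  refine (measure_mono ?_).trans (mainTheorem6_general hN hT hp hρ hα
    ⟨πs, hπs.1, hcontr.contractsTo hρ hπs⟩ hδ hrun.isInteraction hrun.abs_subgradient_le
    fun t ht ω hK => (hrun.mirror_step t ht ω hK).1)
  exact fun ω ⟨πc, hπc, hlt⟩ => ⟨πc, hπc.1, hlt⟩
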